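/- **Setting.** Let $\mathcal A^L,\mathcal A^F$ be finite action sets of a leader and a follower, $D\ge 1$, and $X^L,X^F:\mathcal A^L\times\mathcal A^F\to\mathbb R^D$ payoff matrices. Utilities are linear, $u^L(x)=w^L\cdot x$ and $u^F(x)=w^F\cdot x$, where $w^L,w^F$ lie in the simplex $\mathcal W=\{w\ge 0,\ \sum_d w_d=1\}$ and $w^L_d,w^F_d>0$ for all $d$. For each $l$ let $BR(l)\in\operatorname{argmax}_f u^F(X^F(l,f))$; the leader knows $BR$, $X^L$, $X^F$ and $w^L$, but not $w^F$. For a follower weight $w$, a manipulation $(l,f,c)$ is feasible if $c_d\ge 0$ for all $d$ (constraint (C1)) and $w\cdot(X^F(l,f)+c)\ge w\cdot X^F(l,BR(l))$. The optimal manipulation problem (OMP) is to maximise $u^L(X^L(l,f)-c)$ over all $(l,f,c)$ that are feasible for $w=w^F$; let $u^*$ be its optimal value. The game is beneficial if $c=0$ is not an optimal cost. When $(l,f,c)$ is offered, the follower accepts (plays $f$) if $(l,f,c)$ is feasible for $w^F$, and plays $BR(l)$ otherwise. The leader records that the payoff of the action played (including the offer) is preferred over the payoff of every other action. For a set $\mathcal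 D$ of recorded comparisons, $FR(\mathcal D)\subseteq\mathcal W$ is the set of weights that are consistent with it. **Algorithm (longEU with RWMC, $T\to\infty$).** Start with a (possibly empty) set $\mathcal D^0$ of comparisons between best responses $X^F(l,BR(l))$ and $X^F(l,f)$, and with the best manipulation without cost, $(\hat l,\hat f,\hat c)=(l_0,BR(l_0),0)$ with $l_0\in\operatorname{argmax}_l u^L(X^L(l,BR(l)))$. In round $t=1,2,\dots$: 1. Given the past, draw $\hat w_r$ uniformly from $FR(\mathcal D)$. For every $(l,f)$ let $\hat c_r(l,f)$ be a cost that maximises $u^L(X^L(l,f)-c)$ among the $c$ for which $(l,f,c)$ is feasible for $\hat w_r$. 2. Let $(l_r,f_r)$ maximise over $(l,f)$ the criterion of $(l,f,\hat c_r(l,f))$ with acceptance probability $p=\frac12$. Play $(l^t,f^t,c^t)=(\hat l,\hat f,\hat c)$ if the criterion of $(l_r,f_r,\hat c_r(l_r,f_r))$ with $p=\frac12$ is smaller than that of $(\hat l,\hat f,\hat c)$ with $p=1$; otherwise play $(l^t,f^t,c^t)=(l_r,f_r,\hat c_r(l_r,f_r))$. 3. Observe the follower's action and add the recorded comparisons to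 $\mathcal D$; if the offer was accepted and its leader utility is at least that of $(\hat l,\hat f,\hat c)$, it becomes the new $(\hat l,\hat f,\hat c)$. The criterion for horizon $T$ is $$\mathrm{longEU}(l,f,c\mid t,T)=u^L(X^L(l,f)-c)\,(T-t+1)\,p+\bigl(u^L(X^L(l,BR(l)))+u^L(X^L(\hat l,\hat f)-\hat c)\,(T-t)\bigr)(1-p).$$ The limit $T\to\infty$ is taken in either of two ways: (a) every comparison of criteria is decided as $\mathrm{longEU}(\cdot\mid t,T)$ decides it for all sufficiently large $T$; or (b) the criterion is the asymptotic form $\mathrm{longEU}^+(l,f,c)=\bigl(u^L(X^L(l,f)-c)-u^L(X^L(\hat l,\hat f)-\hat c)\bigr)\,p$. Ties may be broken arbitrarily. **Theorem.** For every beneficial game and every run of this algorithm, under (a) and under (b), the manipulation converges to the optimal manipulation of (OMP) as $t\to\infty$: 1. for every $\varepsilon>0$, the probability that there is an optimal solution $(l^*,f^*,c^*)$ of (OMP) with $l^*=l^t$, $f^*=f^t$ and $\|c^t-c^*\|_\infty<\varepsilon$ tends to $1$ (in particular, if the optimal cost $c^*$ is unique, then $c^t\to c^*$ in probability); 2. almost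 surely, $u^L(X^L(l^t,f^t)-c^t)\to u^*$. -/

import Mathlib

open MeasureTheory ProbabilityTheory Filter Topology

namespace Stackelberg

/-- Payoffs, costs and utility weights in `D = n + 1` objectives. -/
abbrev Vec (n : ℕ) := Fin (n + 1) → ℝ

/-- The linear utility `u(x; w) = ∑ d, w d * x d`. -/
def util {n : ℕ} (w x : Vec n) : ℝ := ∑ d, w d * x d

/-- A manipulation: leader's action, manipulated (follower's) action, manipulation cost. -/
@[ext] structure Manip (n : ℕ) (L F : Type*) where
  lead : L
  foll : F
  cost : Vec n

/-- A multi-objective Stackelberg game with linear utilities and normalised weights.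
`BR l` is the follower's best response to `l`. -/
structure Game (n : ℕ) (L F : Type*) where
  XL : L → F → Vec n
  XF : L → F → Vec n
  wL : Vec n
  wF : Vec n
  wL_mem : wL ∈ stdSimplex ℝ (Fin (n + 1))
  wF_mem : wF ∈ stdSimplex ℝ (Fin (n + 1))
  BR : L → F
  BR_spec : ∀ l f, util wF (XF l f) ≤ util wF (XF l (BR l))

/-- A pairwise comparison `(x, y, z)`: `z = true` says that the follower prefers `x` over `y`. -/
structure Comparison (n : ℕ) where
  x : Vec n
  y : Vec n
  z : Bool

/-- The feasible region: all normalised weights that are consistent with the comparisons. -/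
def feasibleRegion {n : ℕ} (D : Set (Comparison n)) : Set (Vec n) :=
  {w | w ∈ stdSimplex ℝ (Fin (n + 1)) ∧
    ∀ q ∈ D, (util w q.y ≤ util w q.x ↔ q.z = true)}

/-- Lebesgue measure on the hyperplane `∑ d, w d = 1`, in the coordinates `w 1, …, w n`
(the remaining coordinate is `w 0 = 1 - ∑ i, w (i + 1)`). -/
noncomputable def hyperplaneMeasure (n : ℕ) : Measure (Vec n) :=
  Measure.map (fun y : Fin n → ℝ => (Fin.cons (1 - ∑ i, y i) y : Vec n)) volume

/-- The uniform distribution on a set `S` of normalised weights. -/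
noncomputable def uniformLaw {n : ℕ} (S : Set (Vec n)) : Measure (Vec n) :=
  ProbabilityTheory.cond (hyperplaneMeasure n) S

namespace Game

variable {n : ℕ} {L F : Type*} (G : Game n L F)

/-- Utility of the leader if the manipulation is accepted. -/
def leaderUtil (m : Manip n L F) : ℝ := util G.wL (G.XL m.lead m.foll - m.cost)

/-- Utility of the leader for the action `l` if the follower plays the best response `BR l`. -/
def leaderUtilBR (l : L) : ℝ := util G.wL (G.XL l (G.BR l))

/-- The constraints (C1) (nonnegative cost) and (IC), for a follower with weight `w`. -/
def Feasible (w : Vec n) (m : Manip n L F) : Prop :=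
  (∀ d, 0 ≤ m.cost d) ∧
    util w (G.XF m.lead (G.BR m.lead)) ≤ util w (G.XF m.lead m.foll + m.cost)

/-- Solutions of the optimal manipulation problem (OMP), posed with the true follower weight. -/
def IsOptimal (m : Manip n L F) : Prop :=
  G.Feasible G.wF m ∧ ∀ m', G.Feasible G.wF m' → G.leaderUtil m' ≤ G.leaderUtil m

/-- A beneficial game: the zero cost is not an optimal cost. -/
def Beneficial : Prop := ∀ m, G.IsOptimal m → m.cost ≠ 0

/-- `c` is a minimal cost (in terms of the leader's utility) for `(l, f)`, that is, a solution of
(OMP) with `l`, `f` and the follower weight `w` substituted. -/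
def IsMinimalCost (w : Vec n) (l : L) (f : F) (c : Vec n) : Prop :=
  G.Feasible w ⟨l, f, c⟩ ∧
    ∀ c', G.Feasible w ⟨l, f, c'⟩ → G.leaderUtil ⟨l, f, c'⟩ ≤ G.leaderUtil ⟨l, f, c⟩

/-- The follower accepts an offer if the manipulated action becomes at least as good for him as
his best response without manipulation. -/
def Accepts (m : Manip n L F) : Prop :=
  util G.wF (G.XF m.lead (G.BR m.lead)) ≤ util G.wF (G.XF m.lead m.foll + m.cost)

open Classical in
/-- The action that the follower plays when `m` is offered. -/
noncomputable def response (m : Manip n L F) : F :=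
  if G.Accepts m then m.foll else G.BR m.lead

open Classical in
/-- The follower's payoff for the action `r` when `m` is offered. -/
noncomputable def offeredPayoff (m : Manip n L F) (r : F) : Vec n :=
  if r = m.foll then G.XF m.lead r + m.cost else G.XF m.lead r

/-- What the leader learns from a round: the payoff of the action that was played is preferred
over the payoff of every other action. -/
def feedback (m : Manip n L F) : Set (Comparison n) :=
  {q | ∃ r, r ≠ G.response m ∧
    q = ⟨G.offeredPayoff m (G.response m), G.offeredPayoff m r, true⟩}

/-- The comparisons that express the best responses `BR l`. -/
def bestResponseData : Set (Comparison n) :=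
  {q | ∃ l f, f ≠ G.BR l ∧ q = ⟨G.XF l (G.BR l), G.XF l f, true⟩}

/-- The long-term expected utility of `m` in round `t` of `T`, when `p` is the probability that
`m` is accepted and `best` is the current best manipulation. -/
noncomputable def longEU (best m : Manip n L F) (p : ℝ) (t T : ℕ) : ℝ :=
  G.leaderUtil m * ((T : ℝ) - t + 1) * p +
    (G.leaderUtilBR m.lead + G.leaderUtil best * ((T : ℝ) - t)) * (1 - p)

/-- The asymptotic form of `longEU`. -/
noncomputable def longEUPlus (best m : Manip n L F) (p : ℝ) : ℝ :=
  (G.leaderUtil m - G.leaderUtil best) * p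

end Game

/-- Two ways to let the horizon `T` of the policy tend to infinity: decide as the policy with
the criterion `longEU` and horizon `T` decides for all sufficiently large `T`, or decide by the
asymptotic criterion `longEUPlus`. -/
inductive Criterion
  | largeHorizon
  | asymptotic

/-- In round `t`, the manipulation `m` (accepted with probability `p`) scores at least as much as
`m'` (accepted with probability `p'`). -/
def Game.ScoresAtLeast {n : ℕ} {L F : Type*} (G : Game n L F) (crit : Criterion) (t : ℕ)
    (best m : Manip n L F) (p : ℝ) (m' : Manip n L F) (p' : ℝ) : Prop :=
  match crit with
  | .largeHorizon => ∀ᶠ T : ℕ in atTop, G.longEU best m' p' t T ≤ G.longEU best m p t T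
  | .asymptotic => G.longEUPlus best m' p' ≤ G.longEUPlus best m p

/-- A run of the policy with random-weight minimal cost (constraint (C1), known best responses,
infinite horizon), started with the comparisons `D₀`. The sequences are indexed by `t = 0, 1, …`;
the index `t` belongs to round `t + 1`. -/
structure Run {n : ℕ} {L F : Type*} (G : Game n L F) (crit : Criterion)
    (D₀ : Set (Comparison n)) {Ω : Type*} [mΩ : MeasurableSpace Ω] (P : Measure Ω) where
  /-- `ℱ t` is the information before the weight of index `t` is drawn. -/
  ℱ : Filtration ℕ mΩ
  data : ℕ → Ω → Set (Comparison n)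
  weight : ℕ → Ω → Vec n
  minCost : ℕ → Ω → L → F → Vec n
  /-- The pair `(l_r, f_r)`. -/
  pair : ℕ → Ω → L × F
  /-- The manipulation that is played. -/
  offer : ℕ → Ω → Manip n L F
  /-- The current best manipulation at the beginning of the round. -/
  best : ℕ → Ω → Manip n L F
  measurable_weight : ∀ t, Measurable[ℱ (t + 1)] (weight t)
  measurable_minCost : ∀ t l f, Measurable[ℱ (t + 1)] (fun ω => minCost t ω l f)
  measurable_pair : ∀ t q, MeasurableSet[ℱ (t + 1)] {ω | pair t ω = q}
  data_zero : ∀ ω, data 0 ω = D₀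
  /-- The best responses are known, so the best manipulation at the start is the best of the
  actions of the leader without manipulation. -/
  best_zero : ∃ l₀, (∀ l, G.leaderUtilBR l ≤ G.leaderUtilBR l₀) ∧
    ∀ ω, best 0 ω = ⟨l₀, G.BR l₀, 0⟩
  /-- The weight is drawn from the feasible region, and given the past it is uniform there. -/
  weight_mem : ∀ t ω, weight t ω ∈ feasibleRegion (data t ω)
  weight_law : ∀ t (B : Set (Vec n)), MeasurableSet B →
    P[(weight t ⁻¹' B).indicator (fun _ => (1 : ℝ)) | ℱ t] =ᵐ[P]
      fun ω => (uniformLaw (feasibleRegion (data t ω))).real B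
  minCost_spec : ∀ t ω l f, G.IsMinimalCost (weight t ω) l f (minCost t ω l f)
  /-- `(l_r, f_r)` maximises the criterion, with acceptance probability `1 / 2`. -/
  pair_spec : ∀ t ω l f, G.ScoresAtLeast crit (t + 1) (best t ω)
    ⟨(pair t ω).1, (pair t ω).2, minCost t ω (pair t ω).1 (pair t ω).2⟩ (1 / 2)
    ⟨l, f, minCost t ω l f⟩ (1 / 2)
  /-- Explore the new candidate unless it scores less than the current best manipulation, which
  is accepted with probability `1`; in that case play the current best manipulation. -/
  offer_explore : ∀ t ω,
    G.ScoresAtLeast crit (t + 1) (best t ω)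
      ⟨(pair t ω).1, (pair t ω).2, minCost t ω (pair t ω).1 (pair t ω).2⟩ (1 / 2)
      (best t ω) 1 →
    offer t ω = ⟨(pair t ω).1, (pair t ω).2, minCost t ω (pair t ω).1 (pair t ω).2⟩
  offer_exploit : ∀ t ω,
    ¬ G.ScoresAtLeast crit (t + 1) (best t ω)
      ⟨(pair t ω).1, (pair t ω).2, minCost t ω (pair t ω).1 (pair t ω).2⟩ (1 / 2)
      (best t ω) 1 →
    offer t ω = best t ω
  data_succ : ∀ t ω, data (t + 1) ω = data t ω ∪ G.feedback (offer t ω)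
  best_update : ∀ t ω, G.Accepts (offer t ω) →
    G.leaderUtil (best t ω) ≤ G.leaderUtil (offer t ω) → best (t + 1) ω = offer t ω
  best_keep : ∀ t ω,
    ¬ (G.Accepts (offer t ω) ∧ G.leaderUtil (best t ω) ≤ G.leaderUtil (offer t ω)) →
    best (t + 1) ω = best t ω

end Stackelberg

/-! Write v(w) for `optValue w`, u* = v(`wF`), and S for the intersection of all feasible regions of
a run; S is convex and contains `wF`. As the horizon tends to infinity, criteria are compared by
leader utilities, up to ties. Hence the candidate is worth exactly v(w), where w is the drawn
weight, and every offer is worth at least the candidate and at least the current best manipulation.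

Almost surely the drawn weights come arbitrarily close to every point y of S (`ae_visits`): a
homothety with centre y and small ratio r maps the convex region into itself and close to y, so each
round hits a neighbourhood of y with conditional probability at least r^n, and the conditional
Borel–Cantelli lemma applies.

Given this, the convergence of utilities is deterministic (`tendsto_leaderUtil_offer`). The slack of
a rejected offer has utility at most 0 at the drawn weight and at least 0 on all later regions,
hence on S. So for a, b in S, a draw close enough to a point of the segment from a to b other than a
cannot lead to a rejection whose slack has utility bounded away from 0 at b. If offers were worth
more than u* + ε infinitely often, some x in S would have v(x) > u*; with a = x and b = `wF`, offers
near x demand too much and are rejected with a margin at `wF`, a contradiction. If they were worth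
less than u* - ε infinitely often, some x in S would have v(x) < u*; with a = `wF` and b = x, an
offer worth almost u* has a margin at x, so it must be accepted, and later offers are worth at least
as much.

Convergence of utilities does not exclude rejections. `tendsto_measure_rejected` shows that
rejection by a fixed margin has probability tending to 0, and by compactness (`exists_near_optimal`)
an almost feasible offer worth almost u* is close to an optimal one. -/

namespace Stackelberg

/-! ### Linear utilities and their bounds on the simplex. -/

section Util

variable {n : ℕ} {w w' a b x y : Vec n}

lemma util_add (w x y : Vec n) : util w (x + y) = util w x + util w y := by
  simp [util, mul_add, Finset.sum_add_distrib]

lemma util_sub (w x y : Vec n) : util w (x - y) = util w x - util w y := by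
  simp [util, mul_sub, Finset.sum_sub_distrib]

lemma util_sub_left (w w' x : Vec n) : util (w - w') x = util w x - util w' x := by
  simp [util, sub_mul, Finset.sum_sub_distrib]

lemma util_combo (r s : ℝ) (a b x : Vec n) :
    util (r • a + s • b) x = r * util a x + s * util b x := by
  simp only [util, Pi.add_apply, Pi.smul_apply, smul_eq_mul, add_mul, Finset.sum_add_distrib,
    Finset.mul_sum, mul_assoc]

lemma util_const (hw : w ∈ stdSimplex ℝ (Fin (n + 1))) (r : ℝ) :
    util w (fun _ => r) = r := by
  rw [util, ← Finset.sum_mul, hw.2, one_mul]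

lemma abs_util_le (hw : w ∈ stdSimplex ℝ (Fin (n + 1))) (x : Vec n) : |util w x| ≤ ‖x‖ := by
  calc |util w x| ≤ ∑ d, |w d * x d| := Finset.abs_sum_le_sum_abs _ _
    _ ≤ ∑ d, w d * ‖x‖ := by
        refine Finset.sum_le_sum fun d _ => ?_
        rw [abs_mul, abs_of_nonneg (hw.1 d)]
        exact mul_le_mul_of_nonneg_left (norm_le_pi_norm x d) (hw.1 d)
    _ = ‖x‖ := util_const hw _

lemma abs_util_sub_le (w w' x : Vec n) :
    |util w x - util w' x| ≤ (n + 1) * ‖x‖ * ‖w - w'‖ := by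
  rw [← util_sub_left]
  calc |util (w - w') x| ≤ ∑ d, |(w - w') d * x d| := Finset.abs_sum_le_sum_abs _ _
    _ ≤ ∑ _d : Fin (n + 1), ‖x‖ * ‖w - w'‖ := by
        refine Finset.sum_le_sum fun d _ => ?_
        rw [abs_mul, mul_comm]
        exact mul_le_mul (norm_le_pi_norm x d) (norm_le_pi_norm (w - w') d) (abs_nonneg _)
          (norm_nonneg _)
    _ = (n + 1) * ‖x‖ * ‖w - w'‖ := by simp [mul_assoc]

lemma util_nonneg (hw : ∀ d, 0 ≤ w d) (hx : ∀ d, 0 ≤ x d) : 0 ≤ util w x :=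
  Finset.sum_nonneg fun d _ => mul_nonneg (hw d) (hx d)

lemma mul_le_util (hw : ∀ d, 0 ≤ w d) (hx : ∀ d, 0 ≤ x d) (d : Fin (n + 1)) :
    w d * x d ≤ util w x :=
  Finset.single_le_sum (f := fun d => w d * x d) (fun d _ => mul_nonneg (hw d) (hx d))
    (Finset.mem_univ d)

lemma continuous_util_right (w : Vec n) : Continuous (util w) := by
  unfold util; fun_prop

lemma continuous_util_left (x : Vec n) : Continuous (fun w => util w x) := by
  unfold util; fun_prop

lemma norm_sub_le_one_of_mem_stdSimplex (ha : a ∈ stdSimplex ℝ (Fin (n + 1)))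
    (hb : b ∈ stdSimplex ℝ (Fin (n + 1))) : ‖a - b‖ ≤ 1 := by
  refine (pi_norm_le_iff_of_nonneg zero_le_one).2 fun d => ?_
  have h : ∀ {c : Vec n}, c ∈ stdSimplex ℝ (Fin (n + 1)) → 0 ≤ c d ∧ c d ≤ 1 := fun hc =>
    ⟨hc.1 d, hc.2 ▸ Finset.single_le_sum (fun i _ => hc.1 i) (Finset.mem_univ d)⟩
  rw [Pi.sub_apply, Real.norm_eq_abs, abs_le]
  constructor <;> linarith [(h ha).1, (h ha).2, (h hb).1, (h hb).2]

end Util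

/-! ### The optimal value as a function of the follower's weight, and stability of optimal costs. -/

namespace Game

variable {n : ℕ} {L F : Type*} (G : Game n L F)

/-- By how much a follower with weight `w` prefers his best response is `util w (G.slack m)`. -/
def slack (m : Manip n L F) : Vec n :=
  G.XF m.lead (G.BR m.lead) - G.XF m.lead m.foll - m.cost

/-- The optimal value of the manipulation problem for a follower with weight `w`. -/
noncomputable def optValue (w : Vec n) : ℝ := sSup (G.leaderUtil '' {m | G.Feasible w m})

lemma util_slack (w : Vec n) (m : Manip n L F) : util w (G.slack m) =
    util w (G.XF m.lead (G.BR m.lead)) - util w (G.XF m.lead m.foll + m.cost) := by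
  rw [slack, util_sub, util_sub, util_add]; ring

lemma feasible_iff (w : Vec n) (m : Manip n L F) :
    G.Feasible w m ↔ (∀ d, 0 ≤ m.cost d) ∧ util w (G.slack m) ≤ 0 := by
  rw [Feasible, util_slack, sub_nonpos]

lemma accepts_iff (m : Manip n L F) : G.Accepts m ↔ util G.wF (G.slack m) ≤ 0 := by
  rw [Accepts, util_slack, sub_nonpos]

lemma leaderUtil_eq (m : Manip n L F) :
    G.leaderUtil m = util G.wL (G.XL m.lead m.foll) - util G.wL m.cost := util_sub _ _ _

lemma feasible_bestResponse (w : Vec n) (l : L) : G.Feasible w ⟨l, G.BR l, 0⟩ := by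
  simp [Feasible]

variable [Fintype L] [Fintype F]

lemma exists_payoff_bound : ∃ M : ℝ, 0 ≤ M ∧ ∀ l f, |util G.wL (G.XL l f)| ≤ M ∧
    ‖G.XF l (G.BR l) - G.XF l f‖ ≤ M := by
  refine ⟨∑ p : L × F, (|util G.wL (G.XL p.1 p.2)| + ‖G.XF p.1 (G.BR p.1) - G.XF p.1 p.2‖),
    Finset.sum_nonneg fun p _ => by positivity, fun l f => ?_⟩
  have h := Finset.single_le_sum (f := fun p : L × F => |util G.wL (G.XL p.1 p.2)| +
    ‖G.XF p.1 (G.BR p.1) - G.XF p.1 p.2‖) (fun p _ => by positivity) (Finset.mem_univ (l, f))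
  constructor <;>
    linarith [abs_nonneg (util G.wL (G.XL l f)), norm_nonneg (G.XF l (G.BR l) - G.XF l f)]

lemma bddAbove_leaderUtil (w : Vec n) : BddAbove (G.leaderUtil '' {m | G.Feasible w m}) := by
  obtain ⟨M, -, hM⟩ := G.exists_payoff_bound
  refine ⟨M, ?_⟩
  rintro _ ⟨m, hm, rfl⟩
  rw [leaderUtil_eq]
  linarith [(abs_le.1 (hM m.lead m.foll).1).2, util_nonneg G.wL_mem.1 hm.1]

lemma leaderUtil_le_optValue {w : Vec n} {m : Manip n L F} (hm : G.Feasible w m) :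
    G.leaderUtil m ≤ G.optValue w :=
  le_csSup (G.bddAbove_leaderUtil w) ⟨m, hm, rfl⟩

/-- Adding `r` to every coordinate of the cost restores feasibility and costs the leader exactly
`r`, because both weights sum to one. -/
lemma leaderUtil_sub_le_optValue {w : Vec n} (hw : w ∈ stdSimplex ℝ (Fin (n + 1)))
    {m : Manip n L F} (hm : ∀ d, 0 ≤ m.cost d) {r : ℝ} (hr : 0 ≤ r)
    (h : util w (G.slack m) ≤ r) : G.leaderUtil m - r ≤ G.optValue w := by
  have key : G.Feasible w ⟨m.lead, m.foll, m.cost + fun _ => r⟩ := by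
    rw [feasible_iff]
    refine ⟨fun d => add_nonneg (hm d) hr, ?_⟩
    rw [util_slack, util_add, util_add, util_const hw]
    rw [util_slack, util_add] at h
    linarith
  refine le_trans (le_of_eq ?_) (G.leaderUtil_le_optValue key)
  rw [leaderUtil_eq, leaderUtil_eq, util_add, util_const G.wL_mem]
  ring

lemma lt_util_slack {w : Vec n} (hw : w ∈ stdSimplex ℝ (Fin (n + 1)))
    {m : Manip n L F} (hm : ∀ d, 0 ≤ m.cost d) {r : ℝ} (hr : 0 ≤ r)
    (h : G.optValue w + r < G.leaderUtil m) : r < util w (G.slack m) := by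
  by_contra! hc
  linarith [G.leaderUtil_sub_le_optValue hw hm hr hc]

/-- Positivity of `wL` makes the leader's loss coercive on nonnegative costs. This supplies the
compactness used throughout. -/
lemma exists_cost_bound (hwL : ∀ d, 0 < G.wL d) (b : ℝ) : ∃ C : ℝ, 0 < C ∧
    ∀ m : Manip n L F, (∀ d, 0 ≤ m.cost d) → b ≤ G.leaderUtil m →
      ‖m.cost‖ ≤ C ∧ ‖G.slack m‖ ≤ C := by
  obtain ⟨M, hM0, hM⟩ := G.exists_payoff_bound
  have hK : ∀ d, 0 ≤ (M + |b|) / G.wL d := fun d => div_nonneg (by positivity) (hwL d).le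
  have hK' : 0 ≤ ∑ d, (M + |b|) / G.wL d := Finset.sum_nonneg fun d _ => hK d
  refine ⟨M + 1 + ∑ d, (M + |b|) / G.wL d, by positivity, fun m hm hb => ?_⟩
  have hc : ‖m.cost‖ ≤ ∑ d, (M + |b|) / G.wL d := by
    refine (pi_norm_le_iff_of_nonneg hK').2 fun d => ?_
    rw [Real.norm_eq_abs, abs_of_nonneg (hm d)]
    refine le_trans ?_ (Finset.single_le_sum (fun d _ => hK d) (Finset.mem_univ d))
    rw [le_div_iff₀ (hwL d), mul_comm]
    rw [leaderUtil_eq] at hb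
    linarith [mul_le_util (fun d => (hwL d).le) hm d, (abs_le.1 (hM m.lead m.foll).1).2,
      neg_abs_le b]
  refine ⟨by linarith, ?_⟩
  have := norm_sub_le (G.XF m.lead (G.BR m.lead) - G.XF m.lead m.foll) m.cost
  rw [slack]
  linarith [(hM m.lead m.foll).2]

lemma exists_le_optValue [Nonempty L] : ∃ b : ℝ, ∀ w, b ≤ G.optValue w := by
  obtain ⟨l⟩ := ‹Nonempty L›
  exact ⟨_, fun w => G.leaderUtil_le_optValue (G.feasible_bestResponse w l)⟩

/-- A nearly optimal manipulation for `w` has bounded slack, so it violates feasibility for `w'` by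
at most a multiple of `‖w - w'‖`, which can be paid as extra cost. -/
lemma exists_optValue_lipschitz [Nonempty L] (hwL : ∀ d, 0 < G.wL d) : ∃ K : ℝ, 0 < K ∧
    ∀ w ∈ stdSimplex ℝ (Fin (n + 1)), ∀ w' ∈ stdSimplex ℝ (Fin (n + 1)),
      G.optValue w - K * ‖w - w'‖ ≤ G.optValue w' := by
  obtain ⟨b, hb⟩ := G.exists_le_optValue
  obtain ⟨C, hC, hCm⟩ := G.exists_cost_bound hwL (b - 1)
  refine ⟨(n + 1) * C, by positivity, fun w hw w' hw' => ?_⟩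
  refine le_of_forall_pos_sub_le fun ε hε => ?_
  have hne : (G.leaderUtil '' {m | G.Feasible w m}).Nonempty :=
    ‹Nonempty L›.elim fun l => ⟨_, _, G.feasible_bestResponse w l, rfl⟩
  -- The cap 1 keeps the utility of `m` above `b - 1`, so that `C` does not depend on `ε`.
  obtain ⟨_, ⟨m, hm, rfl⟩, hlt⟩ := exists_lt_of_lt_csSup hne
    (show G.optValue w - min ε 1 < G.optValue w by linarith [lt_min hε one_pos])
  have hm' := (G.feasible_iff w m).1 hm
  have hs := (hCm m hm'.1 (by linarith [hb w, min_le_right ε 1])).2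
  have h1 := (abs_le.1 (abs_util_sub_le w w' (G.slack m))).1
  have h2 : (n + 1) * ‖G.slack m‖ * ‖w - w'‖ ≤ (n + 1) * C * ‖w - w'‖ := by gcongr
  have h3 := G.leaderUtil_sub_le_optValue hw' hm'.1 (r := (n + 1) * C * ‖w - w'‖)
    (by positivity) (by linarith)
  linarith [min_le_left ε 1]

lemma IsOptimal.leaderUtil_eq_optValue {m : Manip n L F} (hm : G.IsOptimal m) :
    G.leaderUtil m = G.optValue G.wF :=
  le_antisymm (G.leaderUtil_le_optValue hm.1)
    (csSup_le ⟨_, m, hm.1, rfl⟩ (by rintro _ ⟨m', hm', rfl⟩; exact hm.2 m' hm'))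

lemma isOptimal_of_optValue_le {m : Manip n L F} (hm : G.Feasible G.wF m)
    (h : G.optValue G.wF ≤ G.leaderUtil m) : G.IsOptimal m :=
  ⟨hm, fun _ hm' => (G.leaderUtil_le_optValue hm').trans h⟩

/-- Counterexamples for δ = 1/(k+1) stay bounded, and a limit point of them is feasible with the
optimal value. For a pair without an optimal cost, the statement says that the pair stays away from
being almost feasible and almost optimal. -/
lemma exists_near_optimal_cost (hwL : ∀ d, 0 < G.wL d) {ε : ℝ} (hε : 0 < ε) (l : L) (f : F) :
    ∃ δ : ℝ, 0 < δ ∧ ∀ c : Vec n, (∀ d, 0 ≤ c d) → util G.wF (G.slack ⟨l, f, c⟩) ≤ δ →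
      G.optValue G.wF - δ ≤ G.leaderUtil ⟨l, f, c⟩ →
      ∃ c', G.IsOptimal ⟨l, f, c'⟩ ∧ ‖c - c'‖ < ε := by
  by_contra! hcon
  have hu : ∀ k : ℕ, (0 : ℝ) < 1 / ((k : ℝ) + 1) := fun k => Nat.one_div_pos_of_nat
  choose c hc0 hc1 hc2 hc3 using fun k : ℕ => hcon (1 / ((k : ℝ) + 1)) (hu k)
  obtain ⟨C, -, hC⟩ := G.exists_cost_bound hwL (G.optValue G.wF - 1)
  have hb : ∀ k, c k ∈ Metric.closedBall (0 : Vec n) C := fun k => by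
    rw [mem_closedBall_zero_iff]
    refine (hC ⟨l, f, c k⟩ (hc0 k) ?_).1
    have : 1 / ((k : ℝ) + 1) ≤ 1 := by
      rw [div_le_one (by positivity)]; linarith [(Nat.cast_nonneg k : (0 : ℝ) ≤ k)]
    linarith [hc2 k]
  obtain ⟨c', -, φ, hφ, hlim⟩ := (isCompact_closedBall (0 : Vec n) C).tendsto_subseq hb
  have hz : Tendsto (fun k => 1 / (((φ k : ℕ) : ℝ) + 1)) atTop (𝓝 0) :=
    tendsto_one_div_add_atTop_nhds_zero_nat.comp hφ.tendsto_atTop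
  have hs : Continuous fun c : Vec n => util G.wF (G.slack ⟨l, f, c⟩) :=
    (continuous_util_right _).comp
      (show Continuous fun c : Vec n => G.XF l (G.BR l) - G.XF l f - c by fun_prop)
  have hv : Continuous fun c : Vec n => G.leaderUtil ⟨l, f, c⟩ :=
    (continuous_util_right _).comp
      (show Continuous fun c : Vec n => G.XL l f - c by fun_prop)
  have hfeas : G.Feasible G.wF ⟨l, f, c'⟩ := by
    rw [feasible_iff]
    refine ⟨fun d => ge_of_tendsto' (((continuous_apply d).tendsto c').comp hlim)
      fun k => hc0 _ d, ?_⟩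
    exact le_of_tendsto_of_tendsto' ((hs.tendsto c').comp hlim) hz fun k => hc1 _
  have hval : G.optValue G.wF ≤ G.leaderUtil ⟨l, f, c'⟩ := by
    have h0 : Tendsto (fun k => G.optValue G.wF - 1 / (((φ k : ℕ) : ℝ) + 1)) atTop
        (𝓝 (G.optValue G.wF)) := by simpa using tendsto_const_nhds.sub hz
    exact le_of_tendsto_of_tendsto' h0 ((hv.tendsto c').comp hlim) fun k => hc2 _
  have hd : Tendsto (fun k => ‖c (φ k) - c'‖) atTop (𝓝 0) :=
    tendsto_iff_norm_sub_tendsto_zero.1 hlim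
  obtain ⟨k, hk⟩ := (hd.eventually (gt_mem_nhds hε)).exists
  exact absurd hk (not_lt.2 (hc3 _ c' (G.isOptimal_of_optValue_le hfeas hval)))

lemma exists_near_optimal (hwL : ∀ d, 0 < G.wL d) {ε : ℝ} (hε : 0 < ε) :
    ∃ δ : ℝ, 0 < δ ∧ ∀ m : Manip n L F, (∀ d, 0 ≤ m.cost d) →
      util G.wF (G.slack m) < δ → G.optValue G.wF - δ < G.leaderUtil m →
      ∃ m', G.IsOptimal m' ∧ m'.lead = m.lead ∧ m'.foll = m.foll ∧ ‖m.cost - m'.cost‖ < ε := by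
  choose δ hδ h using G.exists_near_optimal_cost hwL hε
  have hev : ∀ᶠ r : ℝ in 𝓝[>] 0, 0 < r ∧ ∀ p : L × F, r ≤ δ p.1 p.2 :=
    (eventually_mem_nhdsWithin (a := (0 : ℝ)) (s := Set.Ioi 0)).and (eventually_all.2 fun p =>
      nhdsWithin_le_nhds (eventually_le_nhds (hδ p.1 p.2)))
  obtain ⟨δ', hδ', hle⟩ := hev.exists
  refine ⟨δ', hδ', fun m hm hs hv => ?_⟩
  have hle' := hle (m.lead, m.foll)
  obtain ⟨c', h1, h2⟩ := h m.lead m.foll m.cost hm (hs.le.trans hle')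
    (by change _ ≤ G.leaderUtil m; linarith)
  exact ⟨⟨m.lead, m.foll, c'⟩, h1, rfl, rfl, h2⟩

end Game

/-! ### Contractions and the uniform distribution on a convex set of weights. -/

section UniformLaw

variable {n : ℕ}

/-- The parametrisation of the hyperplane `∑ d, w d = 1` by the coordinates `w 1, …, w n`. -/
def hyperplaneChart (n : ℕ) (y : Fin n → ℝ) : Vec n := Fin.cons (1 - ∑ i, y i) y

lemma measurable_hyperplaneChart (n : ℕ) : Measurable (hyperplaneChart n) := by
  refine measurable_pi_iff.2 fun d => ?_
  refine Fin.cases ?_ (fun i => ?_) d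
  · simp only [hyperplaneChart, Fin.cons_zero]; fun_prop
  · simp only [hyperplaneChart, Fin.cons_succ]; fun_prop

lemma hyperplaneChart_tail {w : Vec n} (hw : w ∈ stdSimplex ℝ (Fin (n + 1))) :
    hyperplaneChart n (Fin.tail w) = w := by
  have h := hw.2
  rw [Fin.sum_univ_succ] at h
  rw [hyperplaneChart, show 1 - ∑ i, Fin.tail w i = w 0 by simp only [Fin.tail]; linarith,
    Fin.cons_self_tail]

lemma hyperplaneChart_homothety (x y : Fin n → ℝ) (r : ℝ) :
    hyperplaneChart n (AffineMap.homothety x r y) =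
      AffineMap.homothety (hyperplaneChart n x) r (hyperplaneChart n y) := by
  ext d
  refine Fin.cases ?_ (fun i => ?_) d
  · simp only [hyperplaneChart, AffineMap.homothety_apply, vsub_eq_sub, vadd_eq_add, Pi.add_apply,
      Pi.smul_apply, Pi.sub_apply, smul_eq_mul, Fin.cons_zero, Finset.sum_add_distrib,
      ← Finset.mul_sum, Finset.sum_sub_distrib]
    ring
  · simp [hyperplaneChart, AffineMap.homothety_apply]

/-- The chart is affine, so a homothety centred in the hyperplane becomes one of ℝ^n and scales
volume by `r ^ n`. The inequality suffices and needs no measurability of the image. -/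
lemma le_hyperplaneMeasure_image_homothety {S : Set (Vec n)} (hS : MeasurableSet S)
    {a : Vec n} (ha : a ∈ stdSimplex ℝ (Fin (n + 1))) {r : ℝ} (hr : 0 ≤ r) :
    ENNReal.ofReal (r ^ n) * hyperplaneMeasure n S ≤
      hyperplaneMeasure n (AffineMap.homothety a r '' S) := by
  have hm := measurable_hyperplaneChart n
  have h1 : hyperplaneMeasure n S = volume (hyperplaneChart n ⁻¹' S) := Measure.map_apply hm hS
  have h2 := Measure.addHaar_image_homothety (volume : Measure (Fin n → ℝ)) (Fin.tail a) r
    (hyperplaneChart n ⁻¹' S)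
  rw [Module.finrank_fin_fun, abs_of_nonneg (pow_nonneg hr n)] at h2
  rw [h1, ← h2]
  refine (measure_mono ?_).trans (Measure.le_map_apply hm.aemeasurable _)
  rintro _ ⟨y, hy, rfl⟩
  refine ⟨_, hy, ?_⟩
  rw [hyperplaneChart_homothety, hyperplaneChart_tail ha]

lemma homothety_image_subset {S : Set (Vec n)} (hS : Convex ℝ S) {a : Vec n} (ha : a ∈ S)
    {r : ℝ} (hr : 0 ≤ r) (hr1 : r ≤ 1) : AffineMap.homothety a r '' S ⊆ S := by
  rintro _ ⟨w, hw, rfl⟩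
  rw [AffineMap.homothety_eq_lineMap]
  exact hS.lineMap_mem ha hw ⟨hr, hr1⟩

lemma homothety_apply_combo (a w : Vec n) (r : ℝ) :
    AffineMap.homothety a r w = (1 - r) • a + r • w := by
  rw [AffineMap.homothety_apply, vsub_eq_sub, vadd_eq_add]; module

/-- A contraction towards a point of `S` stays in `S`, so its image carries at least the fraction `r
^ n` of the mass. `hone` excludes null sets, for which `uniformLaw` is the zero measure. -/
lemma pow_le_uniformLaw_real {S B : Set (Vec n)} (hS : MeasurableSet S) (hconv : Convex ℝ S)
    (hsub : S ⊆ stdSimplex ℝ (Fin (n + 1))) (hone : (uniformLaw S).real Set.univ = 1)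
    {a : Vec n} (ha : a ∈ S) {r : ℝ} (hr : 0 ≤ r) (hr1 : r ≤ 1)
    (hB : AffineMap.homothety a r '' S ⊆ B) : r ^ n ≤ (uniformLaw S).real B := by
  have huniv : (uniformLaw S) Set.univ = 1 := by
    rw [Measure.real] at hone
    rw [← ENNReal.toReal_eq_one_iff]; exact hone
  have hfin : IsProbabilityMeasure (uniformLaw S) := ⟨huniv⟩
  have hunit : (hyperplaneMeasure n S)⁻¹ * hyperplaneMeasure n S = 1 := by
    rw [uniformLaw, cond_apply hS, Set.inter_univ] at huniv; exact huniv
  have hle : ENNReal.ofReal (r ^ n) ≤ uniformLaw S B := by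
    refine le_trans ?_ (measure_mono hB)
    rw [uniformLaw, cond_apply hS,
      Set.inter_eq_self_of_subset_right (homothety_image_subset hconv ha hr hr1)]
    calc ENNReal.ofReal (r ^ n) = (hyperplaneMeasure n S)⁻¹ *
          (ENNReal.ofReal (r ^ n) * hyperplaneMeasure n S) := by
          rw [mul_left_comm, hunit, mul_one]
      _ ≤ _ := by gcongr; exact le_hyperplaneMeasure_image_homothety hS (hsub ha) hr
  have := ENNReal.toReal_mono (measure_ne_top _ B) hle
  rwa [ENNReal.toReal_ofReal (pow_nonneg hr n)] at this

end UniformLaw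

/-! ### Geometry of the feasible region and what feedback reveals. -/

section FeasibleRegion

variable {n : ℕ}

/-- All comparisons of `D` say that the follower prefers the first payoff. -/
def Positive (D : Set (Comparison n)) : Prop := ∀ q ∈ D, q.z = true

lemma Positive.mem_feasibleRegion_iff {D : Set (Comparison n)} (hD : Positive D) (w : Vec n) :
    w ∈ feasibleRegion D ↔
      w ∈ stdSimplex ℝ (Fin (n + 1)) ∧ ∀ q ∈ D, util w q.y ≤ util w q.x :=
  and_congr_right fun _ => forall₂_congr fun q hq => by simp [hD q hq]

lemma Positive.isClosed_feasibleRegion {D : Set (Comparison n)} (hD : Positive D) :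
    IsClosed (feasibleRegion D) := by
  have : feasibleRegion D = stdSimplex ℝ (Fin (n + 1)) ∩
      ⋂ q ∈ D, {w | util w q.y ≤ util w q.x} := by
    ext w; simp [hD.mem_feasibleRegion_iff]
  rw [this]
  exact (isClosed_stdSimplex ℝ _).inter (isClosed_biInter fun q _ =>
    isClosed_le (continuous_util_left _) (continuous_util_left _))

lemma Positive.convex_feasibleRegion {D : Set (Comparison n)} (hD : Positive D) :
    Convex ℝ (feasibleRegion D) := by
  intro a ha b hb r s hr hs hrs
  rw [hD.mem_feasibleRegion_iff] at *
  refine ⟨convex_stdSimplex ℝ _ ha.1 hb.1 hr hs hrs, fun q hq => ?_⟩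
  rw [util_combo, util_combo]
  exact add_le_add (mul_le_mul_of_nonneg_left (ha.2 q hq) hr)
    (mul_le_mul_of_nonneg_left (hb.2 q hq) hs)

lemma feasibleRegion_subset (D : Set (Comparison n)) :
    feasibleRegion D ⊆ stdSimplex ℝ (Fin (n + 1)) := fun _ hw => hw.1

end FeasibleRegion

namespace Game

variable {n : ℕ} {L F : Type*} (G : Game n L F)

lemma positive_bestResponseData : Positive G.bestResponseData := by
  rintro _ ⟨l, f, -, rfl⟩; rfl

lemma positive_feedback (m : Manip n L F) : Positive (G.feedback m) := by
  rintro _ ⟨r, -, rfl⟩; rfl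

lemma foll_ne_of_not_accepts {m : Manip n L F} (hm : ∀ d, 0 ≤ m.cost d) (h : ¬ G.Accepts m) :
    G.BR m.lead ≠ m.foll := by
  intro heq
  refine h ?_
  rw [Accepts, ← heq, util_add]
  linarith [util_nonneg G.wF_mem.1 hm]

lemma wF_consistent_feedback {m : Manip n L F} (hm : ∀ d, 0 ≤ m.cost d) :
    ∀ q ∈ G.feedback m, util G.wF q.y ≤ util G.wF q.x := by
  rintro _ ⟨r, hr, rfl⟩
  by_cases h : G.Accepts m
  · simp only [response, h, if_true] at hr ⊢
    simp only [offeredPayoff, hr, if_true, if_false]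
    exact (G.BR_spec _ _).trans h
  · simp only [response, h, if_false] at hr ⊢
    simp only [offeredPayoff, G.foll_ne_of_not_accepts hm h, if_false]
    split_ifs with hrf
    · rw [hrf]; exact (not_le.1 h).le
    · exact G.BR_spec _ _

/-- A rejection is recorded as a preference for the best response over the improved payoff; this is
the half-space that cuts the region. -/
lemma util_slack_nonneg_of_rejected {m : Manip n L F} (hm : ∀ d, 0 ≤ m.cost d)
    (h : ¬ G.Accepts m) {D : Set (Comparison n)} (hD : G.feedback m ⊆ D) {w : Vec n}
    (hw : w ∈ feasibleRegion D) : 0 ≤ util w (G.slack m) := by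
  have hne := G.foll_ne_of_not_accepts hm h
  have hmem : (⟨G.XF m.lead (G.BR m.lead), G.XF m.lead m.foll + m.cost, true⟩ : Comparison n) ∈
      G.feedback m := by
    refine ⟨m.foll, ?_, ?_⟩
    · simpa only [response, h, if_false] using hne.symm
    · simp [response, h, offeredPayoff, hne]
  have := (hw.2 _ (hD hmem)).2 rfl
  rw [util_slack]
  exact sub_nonneg.2 this

end Game

/-! ### Reduction of both criteria to leader utilities. -/

lemma nonpos_of_eventually_mul_natCast_le {a b : ℝ} (h : ∀ᶠ T : ℕ in atTop, a * T ≤ b) :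
    a ≤ 0 := by
  by_contra! ha
  have ht : Tendsto (fun T : ℕ => a * (T : ℝ)) atTop atTop :=
    tendsto_natCast_atTop_atTop.const_mul_atTop ha
  obtain ⟨T, h1, h2⟩ := (h.and (ht.eventually_gt_atTop b)).exists
  linarith

lemma eventually_mul_natCast_le {a : ℝ} (b : ℝ) (ha : a < 0) :
    ∀ᶠ T : ℕ in atTop, a * T ≤ b :=
  (tendsto_natCast_atTop_atTop.const_mul_atTop_of_neg ha).eventually_le_atBot b

namespace Game

variable {n : ℕ} {L F : Type*} (G : Game n L F)

/-- For large horizons the coefficient of `T` decides; lower-order terms matter only when the leader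
utilities tie. -/
lemma ScoresAtLeast.leaderUtil_le {G : Game n L F} {crit : Criterion} {t : ℕ}
    {best m m' : Manip n L F} (h : G.ScoresAtLeast crit t best m (1 / 2) m' (1 / 2)) :
    G.leaderUtil m' ≤ G.leaderUtil m := by
  cases crit with
  | largeHorizon =>
    have h1 : ∀ᶠ T : ℕ in atTop, (G.leaderUtil m' - G.leaderUtil m) * (T : ℝ) ≤
        (G.leaderUtil m' - G.leaderUtil m) * (t - 1) + G.leaderUtilBR m.lead -
          G.leaderUtilBR m'.lead := by
      filter_upwards [h] with T hT
      simp only [longEU] at hT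
      linarith
    linarith [nonpos_of_eventually_mul_natCast_le h1]
  | asymptotic =>
    simp only [ScoresAtLeast, longEUPlus] at h
    linarith

lemma ScoresAtLeast.leaderUtil_best_le {G : Game n L F} {crit : Criterion} {t : ℕ}
    {best m : Manip n L F} (h : G.ScoresAtLeast crit t best m (1 / 2) best 1) :
    G.leaderUtil best ≤ G.leaderUtil m := by
  cases crit with
  | largeHorizon =>
    have h1 : ∀ᶠ T : ℕ in atTop, (G.leaderUtil best - G.leaderUtil m) * (T : ℝ) ≤
        (G.leaderUtil best - G.leaderUtil m) * t + G.leaderUtil m + G.leaderUtilBR m.lead -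
          2 * G.leaderUtil best := by
      filter_upwards [h] with T hT
      simp only [longEU] at hT
      linarith
    linarith [nonpos_of_eventually_mul_natCast_le h1]
  | asymptotic =>
    simp only [ScoresAtLeast, longEUPlus] at h
    linarith

lemma scoresAtLeast_of_leaderUtil_lt {best m : Manip n L F} (crit : Criterion) (t : ℕ)
    (h : G.leaderUtil best < G.leaderUtil m) :
    G.ScoresAtLeast crit t best m (1 / 2) best 1 := by
  cases crit with
  | largeHorizon =>
    have h1 := eventually_mul_natCast_le ((G.leaderUtil best - G.leaderUtil m) * t +
      G.leaderUtil m + G.leaderUtilBR m.lead - 2 * G.leaderUtil best) (sub_neg.2 h)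
    simp only [ScoresAtLeast]
    filter_upwards [h1] with T hT
    simp only [longEU]
    linarith
  | asymptotic =>
    simp only [ScoresAtLeast, longEUPlus]
    linarith

end Game

/-! ### Invariants of a single run. -/

namespace Run

variable {n : ℕ} {L F : Type*} {G : Game n L F} {crit : Criterion} {D₀ : Set (Comparison n)}
  {Ω : Type*} [MeasurableSpace Ω] {P : Measure Ω} (R : Run G crit D₀ P)

/-- The candidate `(l_r, f_r, c_r)` of a round. -/
def candidate (t : ℕ) (ω : Ω) : Manip n L F :=
  ⟨(R.pair t ω).1, (R.pair t ω).2, R.minCost t ω (R.pair t ω).1 (R.pair t ω).2⟩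

/-- The feasible region at the beginning of a round. -/
def region (t : ℕ) (ω : Ω) : Set (Vec n) := feasibleRegion (R.data t ω)

lemma candidate_feasible (t : ℕ) (ω : Ω) : G.Feasible (R.weight t ω) (R.candidate t ω) :=
  (R.minCost_spec t ω _ _).1

lemma offer_eq_or (t : ℕ) (ω : Ω) :
    (R.offer t ω = R.candidate t ω ∧ G.leaderUtil (R.best t ω) ≤ G.leaderUtil (R.offer t ω)) ∨
      (R.offer t ω = R.best t ω ∧
        G.leaderUtil (R.candidate t ω) ≤ G.leaderUtil (R.offer t ω)) := by
  by_cases h : G.ScoresAtLeast crit (t + 1) (R.best t ω) (R.candidate t ω) (1 / 2) (R.best t ω) 1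
  · have ho : R.offer t ω = R.candidate t ω := R.offer_explore t ω h
    exact Or.inl ⟨ho, ho ▸ h.leaderUtil_best_le⟩
  · have ho := R.offer_exploit t ω h
    refine Or.inr ⟨ho, ?_⟩
    rw [ho]
    by_contra! hc
    exact h (G.scoresAtLeast_of_leaderUtil_lt _ _ hc)

lemma best_feasible (t : ℕ) (ω : Ω) : G.Feasible G.wF (R.best t ω) := by
  induction t with
  | zero =>
    obtain ⟨l₀, -, h⟩ := R.best_zero
    rw [h]; exact G.feasible_bestResponse _ _
  | succ t ih =>
    by_cases h : G.Accepts (R.offer t ω) ∧ G.leaderUtil (R.best t ω) ≤ G.leaderUtil (R.offer t ω)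
    · rw [R.best_update t ω h.1 h.2]
      rcases R.offer_eq_or t ω with ho | ho
      · exact ⟨by rw [ho.1]; exact (R.candidate_feasible t ω).1, h.1⟩
      · rw [ho.1]; exact ih
    · rw [R.best_keep t ω h]; exact ih

lemma offer_cost_nonneg (t : ℕ) (ω : Ω) (d : Fin (n + 1)) : 0 ≤ (R.offer t ω).cost d := by
  rcases R.offer_eq_or t ω with ho | ho <;> rw [ho.1]
  · exact (R.candidate_feasible t ω).1 d
  · exact (R.best_feasible t ω).1 d

lemma best_le_offer (t : ℕ) (ω : Ω) :
    G.leaderUtil (R.best t ω) ≤ G.leaderUtil (R.offer t ω) := by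
  rcases R.offer_eq_or t ω with ho | ho
  · exact ho.2
  · rw [ho.1]

lemma candidate_le_offer (t : ℕ) (ω : Ω) :
    G.leaderUtil (R.candidate t ω) ≤ G.leaderUtil (R.offer t ω) := by
  rcases R.offer_eq_or t ω with ho | ho
  · rw [ho.1]
  · exact ho.2

lemma best_succ_of_accepts {t : ℕ} {ω : Ω} (h : G.Accepts (R.offer t ω)) :
    R.best (t + 1) ω = R.offer t ω :=
  R.best_update t ω h (R.best_le_offer t ω)

lemma leaderUtil_best_mono (ω : Ω) : Monotone fun t => G.leaderUtil (R.best t ω) := by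
  refine monotone_nat_of_le_succ fun t => ?_
  by_cases h : G.Accepts (R.offer t ω)
  · rw [R.best_succ_of_accepts h]; exact R.best_le_offer t ω
  · rw [R.best_keep t ω fun h' => h h'.1]

lemma offer_eq_candidate_of_rejected {t : ℕ} {ω : Ω} (h : ¬ G.Accepts (R.offer t ω)) :
    R.offer t ω = R.candidate t ω := by
  rcases R.offer_eq_or t ω with ho | ho
  · exact ho.1
  · exact absurd (ho.1 ▸ (R.best_feasible t ω).2) h

lemma util_slack_nonpos_of_rejected {t : ℕ} {ω : Ω} (h : ¬ G.Accepts (R.offer t ω)) :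
    util (R.weight t ω) (G.slack (R.offer t ω)) ≤ 0 := by
  rw [R.offer_eq_candidate_of_rejected h]
  exact ((G.feasible_iff _ _).1 (R.candidate_feasible t ω)).2

lemma data_mono (ω : Ω) : Monotone fun t => R.data t ω :=
  monotone_nat_of_le_succ fun t => by rw [R.data_succ]; exact Set.subset_union_left

lemma region_antitone (ω : Ω) : Antitone fun t => R.region t ω :=
  fun _ _ hst _ hw => ⟨hw.1, fun q hq => hw.2 q (R.data_mono ω hst hq)⟩

lemma util_slack_nonneg_of_rejected {s t : ℕ} (hst : s < t) {ω : Ω}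
    (h : ¬ G.Accepts (R.offer s ω)) {w : Vec n} (hw : w ∈ R.region t ω) :
    0 ≤ util w (G.slack (R.offer s ω)) :=
  G.util_slack_nonneg_of_rejected (R.offer_cost_nonneg s ω) h
    (by rw [R.data_succ]; exact Set.subset_union_right) (R.region_antitone ω hst hw)

lemma positive_data (hD₀ : D₀ ⊆ G.bestResponseData) (t : ℕ) (ω : Ω) :
    Positive (R.data t ω) := by
  induction t with
  | zero => rw [R.data_zero]; exact fun q hq => G.positive_bestResponseData q (hD₀ hq)
  | succ t ih =>
    rw [R.data_succ]
    rintro q (hq | hq)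
    exacts [ih q hq, G.positive_feedback _ q hq]

lemma wF_mem_region (hD₀ : D₀ ⊆ G.bestResponseData) (t : ℕ) (ω : Ω) :
    G.wF ∈ R.region t ω := by
  rw [region, (R.positive_data hD₀ t ω).mem_feasibleRegion_iff]
  refine ⟨G.wF_mem, ?_⟩
  induction t with
  | zero =>
    rw [R.data_zero]
    intro q hq
    obtain ⟨l, f, -, rfl⟩ := hD₀ hq
    exact G.BR_spec l f
  | succ t ih =>
    rw [R.data_succ]
    rintro q (hq | hq)
    exacts [ih q hq, G.wF_consistent_feedback (R.offer_cost_nonneg t ω) q hq]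

lemma weight_mem_region (t : ℕ) (ω : Ω) : R.weight t ω ∈ R.region t ω := R.weight_mem t ω

lemma mem_stdSimplex_of_mem_region {t : ℕ} {ω : Ω} {w : Vec n} (hw : w ∈ R.region t ω) :
    w ∈ stdSimplex ℝ (Fin (n + 1)) := hw.1

lemma nonempty_lead (R' : Run G crit D₀ P) : Nonempty L := let ⟨l, _⟩ := R'.best_zero; ⟨l⟩

lemma leaderUtil_offer_lower_bound : ∃ b : ℝ, ∀ t ω, b ≤ G.leaderUtil (R.offer t ω) := by
  obtain ⟨l₀, -, h⟩ := R.best_zero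
  refine ⟨G.leaderUtil ⟨l₀, G.BR l₀, 0⟩, fun t ω => ?_⟩
  rw [← h ω]
  exact (R.leaderUtil_best_mono ω (Nat.zero_le t)).trans (R.best_le_offer t ω)

section Finite

variable [Fintype L] [Fintype F]

lemma exists_slack_bound (hwL : ∀ d, 0 < G.wL d) :
    ∃ C : ℝ, 0 < C ∧ ∀ t ω, ‖G.slack (R.offer t ω)‖ ≤ C := by
  obtain ⟨b, hb⟩ := R.leaderUtil_offer_lower_bound
  obtain ⟨C, hC, h⟩ := G.exists_cost_bound hwL b
  exact ⟨C, hC, fun t ω => (h _ (R.offer_cost_nonneg t ω) (hb t ω)).2⟩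

/-- Maximising first over costs and then over pairs solves the whole problem for the drawn weight;
in particular its supremum is attained. -/
lemma leaderUtil_candidate (t : ℕ) (ω : Ω) :
    G.leaderUtil (R.candidate t ω) = G.optValue (R.weight t ω) := by
  refine le_antisymm (G.leaderUtil_le_optValue (R.candidate_feasible t ω))
    (csSup_le ⟨_, _, R.candidate_feasible t ω, rfl⟩ ?_)
  rintro _ ⟨m, hm, rfl⟩
  exact ((R.minCost_spec t ω m.lead m.foll).2 m.cost hm).trans
    (R.pair_spec t ω m.lead m.foll).leaderUtil_le

lemma offer_le_max (t : ℕ) (ω : Ω) : G.leaderUtil (R.offer t ω) ≤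
    max (G.optValue (R.weight t ω)) (G.optValue G.wF) := by
  rcases R.offer_eq_or t ω with ho | ho <;> rw [ho.1]
  · rw [leaderUtil_candidate]; exact le_max_left _ _
  · exact (G.leaderUtil_le_optValue (R.best_feasible t ω)).trans (le_max_right _ _)

/-- Rejections cannot happen near a point in the relative interior of a segment inside all the
feasible regions if the offers are bounded away from being accepted at the end of the segment. -/
lemma exists_not_rejected (hwL : ∀ d, 0 < G.wL d) {ω : Ω} {a b : Vec n}
    (ha : ∀ t, a ∈ R.region t ω) {θ γ ρ : ℝ} (hθ0 : 0 < θ) (hθ1 : θ ≤ 1) (hγ : 0 < γ)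
    (hρ : 0 < ρ)
    (hvisit : ∀ r > 0, ∃ t, ‖R.weight t ω - ((1 - θ) • a + θ • b)‖ < r) :
    ∃ t, ‖R.weight t ω - ((1 - θ) • a + θ • b)‖ < ρ ∧
      (¬ G.Accepts (R.offer t ω) → util b (G.slack (R.offer t ω)) < γ) := by
  obtain ⟨C, hC, hslack⟩ := R.exists_slack_bound hwL
  -- Slack utilities are `(n + 1) * C`-Lipschitz in the weight, so within this radius they change by
  -- less than `θ * γ`, the margin that a rejection would force at the target point.
  obtain ⟨t, ht⟩ := hvisit (min ρ (θ * γ / ((n + 1) * C))) (lt_min hρ (by positivity))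
  refine ⟨t, ht.trans_le (min_le_left _ _), fun hrej => ?_⟩
  by_contra! hb
  set y := (1 - θ) • a + θ • b with hy
  have h0 := R.util_slack_nonneg_of_rejected (Nat.lt_succ_self t) hrej (ha (t + 1))
  have h1 : θ * γ ≤ util y (G.slack (R.offer t ω)) := by
    rw [hy, util_combo]
    have := mul_le_mul_of_nonneg_left hb hθ0.le
    have := mul_nonneg (sub_nonneg.2 hθ1) h0
    linarith
  have h2 := R.util_slack_nonpos_of_rejected hrej
  have h3 := (abs_le.1 (abs_util_sub_le (R.weight t ω) y (G.slack (R.offer t ω)))).1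
  have h4 : (n + 1) * ‖G.slack (R.offer t ω)‖ * ‖R.weight t ω - y‖ < θ * γ := by
    calc (n + 1) * ‖G.slack (R.offer t ω)‖ * ‖R.weight t ω - y‖
        ≤ (n + 1) * C * ‖R.weight t ω - y‖ := by gcongr; exact hslack t ω
      _ < (n + 1) * C * (θ * γ / ((n + 1) * C)) := by
          gcongr; exact ht.trans_le (min_le_right _ _)
      _ = θ * γ := by field_simp
  linarith

end Finite

end Run

/-! ### Convergence of the leader's utility along a run whose weights visit every surviving point.
-/

namespace Run

variable {n : ℕ} {L F : Type*} {G : Game n L F} {crit : Criterion} {D₀ : Set (Comparison n)}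
  {Ω : Type*} [MeasurableSpace Ω] {P : Measure Ω} (R : Run G crit D₀ P)

lemma exists_cluster_point (hD₀ : D₀ ⊆ G.bestResponseData) {ω : Ω} {p : ℕ → Prop}
    (hp : ∃ᶠ t in atTop, p t) :
    ∃ x, (∀ t, x ∈ R.region t ω) ∧ ∀ r > 0, ∃ t, p t ∧ ‖R.weight t ω - x‖ < r := by
  obtain ⟨φ, hφ, hpφ⟩ := extraction_of_frequently_atTop hp
  obtain ⟨x, -, ψ, hψ, hlim⟩ := (isCompact_stdSimplex ℝ (Fin (n + 1))).tendsto_subseq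
    fun k => mem_stdSimplex_of_mem_region R (R.weight_mem_region (φ k) ω)
  have hmono : StrictMono (φ ∘ ψ) := hφ.comp hψ
  refine ⟨x, fun t => ?_, fun r hr => ?_⟩
  · refine (R.positive_data hD₀ t ω).isClosed_feasibleRegion.mem_of_tendsto hlim ?_
    filter_upwards [eventually_ge_atTop t] with k hk
    exact R.region_antitone ω (hk.trans (hmono.id_le k)) (R.weight_mem_region _ ω)
  · obtain ⟨k, hk⟩ := ((tendsto_iff_norm_sub_tendsto_zero.1 hlim).eventually
      (gt_mem_nhds hr)).exists
    exact ⟨_, hpφ _, hk⟩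

variable [Fintype L] [Fintype F]

/-- The target point lies a fraction θ of the way from `a` to `b`: θ is small enough to keep the
value close to that of `a`, yet positive, so a margin at `b` is still felt there. -/
lemma exists_near_not_rejected (hwL : ∀ d, 0 < G.wL d) {ω : Ω}
    (hvisit : ∀ y, (∀ t, y ∈ R.region t ω) → ∀ r > 0, ∃ t, ‖R.weight t ω - y‖ < r)
    (hconv : ∀ t, Convex ℝ (R.region t ω)) {a b : Vec n} (ha : ∀ t, a ∈ R.region t ω)
    (hb : ∀ t, b ∈ R.region t ω) {γ δ : ℝ} (hγ : 0 < γ) (hδ : 0 < δ) :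
    ∃ t, G.optValue a - δ ≤ G.leaderUtil (R.offer t ω) ∧
      (¬ G.Accepts (R.offer t ω) → util b (G.slack (R.offer t ω)) < γ) := by
  have := R.nonempty_lead
  obtain ⟨K, hK, hLip⟩ := G.exists_optValue_lipschitz hwL
  have hρ : 0 < δ / (2 * K) := by positivity
  have hθ0 : 0 < min 1 (δ / (2 * K)) := lt_min one_pos hρ
  have hθ1 : min 1 (δ / (2 * K)) ≤ 1 := min_le_left _ _
  set θ := min 1 (δ / (2 * K)) with hθ
  obtain ⟨t, ht, hacc⟩ := R.exists_not_rejected hwL ha hθ0 hθ1 hγ hρ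
    (hvisit ((1 - θ) • a + θ • b) fun t =>
      hconv t (ha t) (hb t) (sub_nonneg.2 hθ1) hθ0.le (by ring))
  refine ⟨t, le_trans ?_ (R.candidate_le_offer t ω), hacc⟩
  rw [leaderUtil_candidate]
  have haS := mem_stdSimplex_of_mem_region R (ha 0)
  have hbS := mem_stdSimplex_of_mem_region R (hb 0)
  refine le_trans ?_
    (hLip a haS _ (mem_stdSimplex_of_mem_region R (R.weight_mem_region t ω)))
  have h1 : ‖((1 - θ) • a + θ • b) - a‖ ≤ θ := by
    rw [show ((1 - θ) • a + θ • b) - a = θ • (b - a) by module, norm_smul, Real.norm_eq_abs,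
      abs_of_pos hθ0]
    exact mul_le_of_le_one_right hθ0.le (norm_sub_le_one_of_mem_stdSimplex hbS haS)
  have h2 : ‖a - R.weight t ω‖ ≤ δ / K := by
    rw [norm_sub_rev]
    calc ‖R.weight t ω - a‖ ≤ ‖R.weight t ω - ((1 - θ) • a + θ • b)‖ +
          ‖((1 - θ) • a + θ • b) - a‖ := norm_sub_le_norm_sub_add_norm_sub _ _ _
      _ ≤ δ / (2 * K) + δ / (2 * K) :=
          add_le_add ht.le (h1.trans (min_le_right _ _))
      _ = δ / K := by field_simp; ring
  have h3 : K * ‖a - R.weight t ω‖ ≤ δ := by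
    rw [mul_comm]; exact (le_div_iff₀ hK).1 h2
  linarith only [h3]

theorem tendsto_leaderUtil_offer (hwL : ∀ d, 0 < G.wL d) (hD₀ : D₀ ⊆ G.bestResponseData) {ω : Ω}
    (hvisit : ∀ y, (∀ t, y ∈ R.region t ω) → ∀ r > 0, ∃ t, ‖R.weight t ω - y‖ < r) :
    Tendsto (fun t => G.leaderUtil (R.offer t ω)) atTop (𝓝 (G.optValue G.wF)) := by
  have := R.nonempty_lead
  have hconv : ∀ t, Convex ℝ (R.region t ω) := fun t =>
    (R.positive_data hD₀ t ω).convex_feasibleRegion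
  have hwF : ∀ t, G.wF ∈ R.region t ω := fun t => R.wF_mem_region hD₀ t ω
  obtain ⟨K, hK, hLip⟩ := G.exists_optValue_lipschitz hwL
  have hupper : ∀ ε > 0, ∀ᶠ t in atTop,
      G.leaderUtil (R.offer t ω) ≤ G.optValue G.wF + ε := by
    intro ε hε
    by_contra hcon
    obtain ⟨x, hx, hxr⟩ := R.exists_cluster_point hD₀ (not_eventually.1 hcon)
    have hxS := mem_stdSimplex_of_mem_region R (hx 0)
    obtain ⟨s, hs, hsr⟩ := hxr (ε / (2 * K)) (by positivity)
    have h1 : G.optValue G.wF + ε < G.optValue (R.weight s ω) := by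
      by_contra! hc
      refine hs ((R.offer_le_max s ω).trans (max_le hc ?_))
      linarith
    have h2 := hLip _ (mem_stdSimplex_of_mem_region R (R.weight_mem_region s ω)) x hxS
    have h3 : K * ‖R.weight s ω - x‖ ≤ ε / 2 := by
      calc K * ‖R.weight s ω - x‖ ≤ K * (ε / (2 * K)) := by gcongr
        _ = ε / 2 := by field_simp
    -- Here `b` is the true weight: the offer is worth over `ε / 8` too much, so it is rejected,
    -- with a margin that `hacc` forbids.
    obtain ⟨t, ht, hacc⟩ := R.exists_near_not_rejected hwL hvisit hconv hx hwF
      (γ := ε / 8) (δ := ε / 4) (by positivity) (by positivity)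
    have h4 := G.lt_util_slack G.wF_mem (R.offer_cost_nonneg t ω) (r := ε / 8) (by positivity)
      (by linarith)
    have h5 := hacc (by rw [G.accepts_iff]; linarith)
    linarith
  have hlower : ∀ ε > 0, ∀ᶠ t in atTop,
      G.optValue G.wF - ε ≤ G.leaderUtil (R.offer t ω) := by
    intro ε hε
    by_contra hcon
    have hfreq := not_eventually.1 hcon
    obtain ⟨x, hx, hxr⟩ := R.exists_cluster_point hD₀ hfreq
    have hxS := mem_stdSimplex_of_mem_region R (hx 0)
    obtain ⟨s, hs, hsr⟩ := hxr (ε / (2 * K)) (by positivity)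
    have h1 := R.candidate_le_offer s ω
    rw [leaderUtil_candidate] at h1
    have h2 := hLip x hxS _ (mem_stdSimplex_of_mem_region R (R.weight_mem_region s ω))
    have h3 : K * ‖x - R.weight s ω‖ ≤ ε / 2 := by
      rw [norm_sub_rev]
      calc K * ‖R.weight s ω - x‖ ≤ K * (ε / (2 * K)) := by gcongr
        _ = ε / 2 := by field_simp
    -- The roles are exchanged: the margin now holds at `x`, so the offer cannot be rejected and
    -- becomes the best manipulation.
    obtain ⟨t, ht, hacc⟩ := R.exists_near_not_rejected hwL hvisit hconv hwF hx
      (γ := ε / 8) (δ := ε / 4) (by positivity) (by positivity)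
    have h4 := G.lt_util_slack hxS (R.offer_cost_nonneg t ω) (r := ε / 8) (by positivity)
      (by linarith)
    have h5 : G.Accepts (R.offer t ω) := by
      by_contra hrej
      linarith [hacc hrej]
    obtain ⟨u, hu, hu'⟩ := (hfreq.and_eventually (eventually_ge_atTop (t + 1))).exists
    have h6 : G.leaderUtil (R.best (t + 1) ω) ≤ G.leaderUtil (R.best u ω) :=
      R.leaderUtil_best_mono ω hu'
    rw [R.best_succ_of_accepts h5] at h6
    linarith [R.best_le_offer u ω]
  refine Metric.tendsto_atTop.2 fun ε hε => ?_
  obtain ⟨N, hN⟩ := eventually_atTop.1 ((hupper (ε / 2) (by positivity)).and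
    (hlower (ε / 2) (by positivity)))
  refine ⟨N, fun t ht => ?_⟩
  rw [Real.dist_eq, abs_lt]
  constructor <;> linarith [(hN t ht).1, (hN t ht).2]

end Run

/-! ### Measurability and adaptedness of the offers. -/

/-- The σ-algebra on manipulations generated by the actions and the cost. -/
instance manipMeasurableSpace (n : ℕ) (L F : Type*) : MeasurableSpace (Manip n L F) :=
  (⊤ : MeasurableSpace (L × F)).comap (fun m => (m.lead, m.foll)) ⊔
    (inferInstance : MeasurableSpace (Vec n)).comap Manip.cost

section Measurability

variable {n : ℕ} {L F : Type*}

lemma measurable_actions :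
    Measurable[_, ⊤] (fun m : Manip n L F => (m.lead, m.foll)) := by
  rw [measurable_iff_comap_le]; exact le_sup_left

lemma measurable_cost : Measurable (Manip.cost : Manip n L F → Vec n) := by
  rw [measurable_iff_comap_le]; exact le_sup_right

lemma measurable_manip_iff {α : Type*} {mα : MeasurableSpace α} {X : α → Manip n L F} :
    Measurable X ↔ Measurable[_, ⊤] (fun a => ((X a).lead, (X a).foll)) ∧
      Measurable (fun a => (X a).cost) := by
  refine ⟨fun h => ⟨measurable_actions.comp h, measurable_cost.comp h⟩, fun h => ?_⟩
  rw [measurable_iff_comap_le, manipMeasurableSpace, MeasurableSpace.comap_sup,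
    MeasurableSpace.comap_comp, MeasurableSpace.comap_comp, sup_le_iff]
  exact ⟨h.1.comap_le, h.2.comap_le⟩

lemma measurable_of_actions {β : Type*} [MeasurableSpace β] (g : L → F → β) :
    Measurable (fun m : Manip n L F => g m.lead m.foll) := by
  have h : Measurable[⊤] (fun p : L × F => g p.1 p.2) := measurable_from_top
  exact h.comp measurable_actions

variable (G : Game n L F)

lemma Game.measurable_leaderUtil : Measurable G.leaderUtil := by
  have h : Measurable fun m : Manip n L F => G.XL m.lead m.foll - m.cost :=
    (measurable_of_actions G.XL).sub measurable_cost
  exact (continuous_util_right G.wL).measurable.comp h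

lemma Game.measurable_slack : Measurable G.slack := by
  have h : Measurable fun m : Manip n L F => G.XF m.lead (G.BR m.lead) - G.XF m.lead m.foll :=
    measurable_of_actions fun l f => G.XF l (G.BR l) - G.XF l f
  exact h.sub measurable_cost

lemma Game.measurable_leaderUtilBR_lead :
    Measurable fun m : Manip n L F => G.leaderUtilBR m.lead :=
  measurable_of_actions fun l _ => G.leaderUtilBR l

lemma Game.measurableSet_accepts : MeasurableSet {m | G.Accepts m} := by
  simp only [Game.accepts_iff]
  exact measurableSet_le ((continuous_util_right _).measurable.comp G.measurable_slack)
    measurable_const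

lemma Game.measurableSet_scoresAtLeast {α : Type*} {mα : MeasurableSpace α} (crit : Criterion)
    (t : ℕ) {best m m' : α → Manip n L F} (hb : Measurable best) (hm : Measurable m)
    (hm' : Measurable m') (p p' : ℝ) :
    MeasurableSet {a | G.ScoresAtLeast crit t (best a) (m a) p (m' a) p'} := by
  have hbu := G.measurable_leaderUtil.comp hb
  have hmu := G.measurable_leaderUtil.comp hm
  have hmu' := G.measurable_leaderUtil.comp hm'
  have hml := G.measurable_leaderUtilBR_lead.comp hm
  have hml' := G.measurable_leaderUtilBR_lead.comp hm'
  simp only [Function.comp_def] at hbu hmu hmu' hml hml'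
  cases crit with
  | largeHorizon =>
    simp only [Game.ScoresAtLeast, eventually_atTop, Game.longEU, Set.ofPred_exists,
      Set.ofPred_forall]
    refine MeasurableSet.iUnion fun N => MeasurableSet.iInter fun T =>
      MeasurableSet.iInter fun _ => measurableSet_le ?_ ?_ <;> fun_prop
  | asymptotic =>
    simp only [Game.ScoresAtLeast, Game.longEUPlus]
    refine measurableSet_le ?_ ?_ <;> fun_prop

end Measurability

namespace Run

variable {n : ℕ} {L F : Type*} {G : Game n L F} {crit : Criterion}
  {D₀ : Set (Comparison n)} {Ω : Type*} [mΩ : MeasurableSpace Ω] {P : Measure Ω}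
  (R : Run G crit D₀ P)

lemma pow_le_uniformLaw_region (hD₀ : D₀ ⊆ G.bestResponseData) {t : ℕ} {ω : Ω}
    (hone : (uniformLaw (R.region t ω)).real Set.univ = 1) {a : Vec n} (ha : a ∈ R.region t ω)
    {r : ℝ} (hr : 0 ≤ r) (hr1 : r ≤ 1) {B : Set (Vec n)}
    (hB : ∀ w ∈ R.region t ω, (1 - r) • a + r • w ∈ B) :
    r ^ n ≤ (uniformLaw (R.region t ω)).real B := by
  refine pow_le_uniformLaw_real (R.positive_data hD₀ t ω).isClosed_feasibleRegion.measurableSet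
    (R.positive_data hD₀ t ω).convex_feasibleRegion (feasibleRegion_subset _) hone ha hr hr1 ?_
  rintro _ ⟨w, hw, rfl⟩
  rw [homothety_apply_combo]
  exact hB w hw

section Measurability

variable [Fintype L] [Fintype F]

lemma measurable_candidate (t : ℕ) : Measurable[R.ℱ (t + 1)] (R.candidate t) := by
  have hp : Measurable[R.ℱ (t + 1), ⊤] (R.pair t) := by
    intro s _
    rw [show R.pair t ⁻¹' s = ⋃ q ∈ s, {ω | R.pair t ω = q} by ext; simp]
    exact MeasurableSet.biUnion (Set.to_countable s) fun q _ => R.measurable_pair t q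
  refine measurable_manip_iff.2 ⟨hp, ?_⟩
  intro B hB
  have : (fun ω => (R.candidate t ω).cost) ⁻¹' B = ⋃ q : L × F,
      {ω | R.pair t ω = q} ∩ (fun ω => R.minCost t ω q.1 q.2) ⁻¹' B := by
    ext ω
    simp [candidate]
  rw [this]
  exact MeasurableSet.iUnion fun q =>
    (R.measurable_pair t q).inter (R.measurable_minCost t q.1 q.2 hB)

lemma measurable_offer_of_best {t : ℕ} (hb : Measurable[R.ℱ t] (R.best t)) :
    Measurable[R.ℱ (t + 1)] (R.offer t) := by
  classical
  have hb' : Measurable[R.ℱ (t + 1)] (R.best t) := hb.mono (R.ℱ.mono (Nat.le_succ t)) le_rfl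
  have hE := G.measurableSet_scoresAtLeast (mα := R.ℱ (t + 1)) crit (t + 1) hb'
    (R.measurable_candidate t) hb' (1 / 2) 1
  have : R.offer t = fun ω => if ω ∈ {ω | G.ScoresAtLeast crit (t + 1) (R.best t ω)
      (R.candidate t ω) (1 / 2) (R.best t ω) 1} then R.candidate t ω else R.best t ω := by
    ext1 ω
    split_ifs with h
    · exact R.offer_explore t ω h
    · exact R.offer_exploit t ω h
  rw [this]
  exact Measurable.ite hE (R.measurable_candidate t) hb'

lemma measurable_best (t : ℕ) : Measurable[R.ℱ t] (R.best t) := by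
  classical
  induction t with
  | zero =>
    obtain ⟨l₀, -, h⟩ := R.best_zero
    rw [show R.best 0 = fun _ => ⟨l₀, G.BR l₀, 0⟩ from funext h]
    exact measurable_const
  | succ t ih =>
    have ho := R.measurable_offer_of_best ih
    have : R.best (t + 1) = fun ω => if ω ∈ R.offer t ⁻¹' {m | G.Accepts m} then R.offer t ω
        else R.best t ω := by
      ext1 ω
      split_ifs with h
      · exact R.best_succ_of_accepts h
      · exact R.best_keep t ω fun h' => h h'.1
    rw [this]
    exact Measurable.ite (ho G.measurableSet_accepts) ho
      (ih.mono (R.ℱ.mono (Nat.le_succ t)) le_rfl)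

lemma measurable_offer (t : ℕ) : Measurable[R.ℱ (t + 1)] (R.offer t) :=
  R.measurable_offer_of_best (R.measurable_best t)

lemma measurable_slack_offer (t : ℕ) :
    Measurable[R.ℱ (t + 1)] (fun ω => G.slack (R.offer t ω)) :=
  G.measurable_slack.comp (R.measurable_offer t)

lemma measurable_leaderUtil_offer (t : ℕ) :
    Measurable (fun ω => G.leaderUtil (R.offer t ω)) :=
  (G.measurable_leaderUtil.comp (R.measurable_offer t)).mono (R.ℱ.le _) le_rfl

end Measurability

/-! ### Recurrence of the drawn weights. -/

variable [IsProbabilityMeasure P]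

/-- The law of the draw applied to the whole space has conditional probability 1, so almost surely
no region is degenerate. -/
lemma ae_uniformLaw_univ :
    ∀ᵐ ω ∂P, ∀ t, (uniformLaw (R.region t ω)).real Set.univ = 1 := by
  rw [ae_all_iff]
  intro t
  have h := R.weight_law t Set.univ MeasurableSet.univ
  rw [Set.preimage_univ, Set.indicator_univ, condExp_const (R.ℱ.le t)] at h
  filter_upwards [h] with ω hω
  exact hω.symm

lemma ae_visits_of_sum (B : Set (Vec n)) (hB : MeasurableSet B) :
    ∀ᵐ ω ∂P, ∀ c > 0, (∀ t, c ≤ (uniformLaw (R.region t ω)).real B) →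
      ∃ t, R.weight t ω ∈ B := by
  -- The shift makes `s (k + 1)` the event of draw `k`, conditioned on `ℱ k`, as Lévy's form of
  -- Borel–Cantelli requires; the empty set fills index 0.
  set s : ℕ → Set Ω := fun k => Nat.casesOn k ∅ fun t => R.weight t ⁻¹' B with hs
  have hsm : ∀ k, MeasurableSet[R.ℱ k] (s k) := by
    rintro (_ | t)
    · exact @MeasurableSet.empty _ (R.ℱ 0)
    · exact R.measurable_weight t hB
  have hlaw : ∀ᵐ ω ∂P, ∀ t, (P[(R.weight t ⁻¹' B).indicator (fun _ => (1 : ℝ)) | R.ℱ t]) ω =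
      (uniformLaw (R.region t ω)).real B := ae_all_iff.2 fun t => R.weight_law t B hB
  filter_upwards [ae_mem_limsup_atTop_iff P hsm, hlaw] with ω hω hlω c hc hle
  have hsum : Tendsto (fun m => ∑ k ∈ Finset.range m,
      (P[(s (k + 1)).indicator (1 : Ω → ℝ) | R.ℱ k]) ω) atTop atTop := by
    refine tendsto_atTop_mono (f := fun m : ℕ => (m : ℝ) * c) (fun m => ?_)
      (tendsto_natCast_atTop_atTop.atTop_mul_const hc)
    rw [← nsmul_eq_mul]
    refine (Finset.card_nsmul_le_sum (Finset.range m) _ c fun k _ => ?_).trans_eq' (by simp)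
    exact (hle k).trans_eq (hlω k).symm
  have hmem := hω.2 hsum
  rw [mem_limsup_iff_frequently_mem] at hmem
  obtain ⟨k, hk⟩ := hmem.exists
  rcases k with _ | t
  · exact hk.elim
  · exact ⟨t, hk⟩

/-- The surviving points depend on ω, so a countable basis is used to obtain one null set for all of
them. -/
lemma ae_visits (hD₀ : D₀ ⊆ G.bestResponseData) :
    ∀ᵐ ω ∂P, ∀ y, (∀ t, y ∈ R.region t ω) → ∀ r > 0, ∃ t, ‖R.weight t ω - y‖ < r := by
  have hb := TopologicalSpace.isBasis_countableBasis (Vec n)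
  have hall : ∀ᵐ ω ∂P, ∀ B ∈ TopologicalSpace.countableBasis (Vec n), ∀ c > 0,
      (∀ t, c ≤ (uniformLaw (R.region t ω)).real B) → ∃ t, R.weight t ω ∈ B :=
    (ae_ball_iff (TopologicalSpace.countable_countableBasis (Vec n))).2 fun B hB =>
      R.ae_visits_of_sum B (hb.isOpen hB).measurableSet
  filter_upwards [hall, R.ae_uniformLaw_univ] with ω hω hone y hy r hr
  obtain ⟨B, hB, hyB, hBr⟩ := hb.exists_subset_of_mem_open
    (Metric.mem_ball_self hr : y ∈ Metric.ball y r) Metric.isOpen_ball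
  obtain ⟨ρ, hρ, hρB⟩ := Metric.isOpen_iff.1 (hb.isOpen hB) y hyB
  have hc0 : 0 < min 1 (ρ / 2) := lt_min one_pos (by positivity)
  obtain ⟨t, ht⟩ := hω B hB (min 1 (ρ / 2) ^ n) (by positivity) fun t => by
    refine R.pow_le_uniformLaw_region hD₀ (hone t) (hy t) hc0.le (min_le_left _ _)
      fun w hw => hρB ?_
    rw [mem_ball_iff_norm, show (1 - min 1 (ρ / 2)) • y + min 1 (ρ / 2) • w - y =
      min 1 (ρ / 2) • (w - y) by module, norm_smul, Real.norm_eq_abs, abs_of_pos hc0]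
    have h1 := norm_sub_le_one_of_mem_stdSimplex (mem_stdSimplex_of_mem_region R hw)
      (mem_stdSimplex_of_mem_region R (hy t))
    calc min 1 (ρ / 2) * ‖w - y‖ ≤ min 1 (ρ / 2) := mul_le_of_le_one_right hc0.le h1
      _ ≤ ρ / 2 := min_le_right _ _
      _ < ρ := by linarith
  exact ⟨t, mem_ball_iff_norm.1 (hBr ht)⟩

end Run

/-! ### Rejections by a fixed margin become improbable. -/

lemma tendsto_measure_first_hit {Ω : Type*} [MeasurableSpace Ω] (P : Measure Ω)
    [IsFiniteMeasure P] {s : ℕ → Set Ω} (hs : ∀ t, MeasurableSet (s t)) :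
    Tendsto (fun t => P (disjointed s t)) atTop (𝓝 0) := by
  -- First-hit events are disjoint, so their measures are summable.
  refine ENNReal.tendsto_atTop_zero_of_tsum_ne_top (ne_top_of_le_ne_top (measure_ne_top P Set.univ)
    (tsum_measure_le_measure_univ (fun t => (MeasurableSet.disjointed hs t).nullMeasurableSet)
      fun i j hij => (disjoint_disjointed s hij).aedisjoint))

namespace Run

variable {n : ℕ} {L F : Type*} {G : Game n L F} {crit : Criterion}
  {D₀ : Set (Comparison n)} {Ω : Type*} [mΩ : MeasurableSpace Ω] {P : Measure Ω} (R : Run G crit D₀ P)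

/-- The offer is rejected by a margin of at least `η` and its slack is within `r` of `v`. -/
def closeRejection (η r : ℝ) (v : Vec n) (t : ℕ) : Set Ω :=
  {ω | η ≤ util G.wF (G.slack (R.offer t ω)) ∧ ‖G.slack (R.offer t ω) - v‖ < r}

lemma not_accepts_of_mem_closeRejection {η r : ℝ} (hη : 0 < η) {v : Vec n} {t : ℕ} {ω : Ω}
    (h : ω ∈ R.closeRejection η r v t) : ¬ G.Accepts (R.offer t ω) := by
  rw [G.accepts_iff]; linarith [h.1]

/-- Earlier rejected slacks have utility at least `η` at `wF` and at least 0 on the region.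
Contracting the region towards `wF` with ratio `1 - r` therefore gives utility at least `r * η`, and
still more than `r * η / 3` after replacing slacks by net points. The contracted copy avoids the set
in question. -/
lemma uniformLaw_le_of_closeRejection (hD₀ : D₀ ⊆ G.bestResponseData) {t : ℕ} {ω : Ω}
    (hone : (uniformLaw (R.region t ω)).real Set.univ = 1) {η r : ℝ} (hη : 0 < η) (hr : 0 < r)
    (hr1 : r < 1) {I : Finset (Vec n)}
    (hI : ∀ v ∈ I, ∃ s < t, ω ∈ R.closeRejection η (r * η / 3) v s) :
    (uniformLaw (R.region t ω)).real (⋃ v ∈ I, {w | util w v ≤ r * η / 3}) ≤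
      1 - (1 - r) ^ n := by
  have hprob : IsProbabilityMeasure (uniformLaw (R.region t ω)) :=
    ⟨by rw [Measure.real, ENNReal.toReal_eq_one_iff] at hone; exact hone⟩
  have hmeas : MeasurableSet (⋃ v ∈ I, {w : Vec n | util w v ≤ r * η / 3}) :=
    Finset.measurableSet_biUnion I fun v _ =>
      measurableSet_le (continuous_util_left v).measurable measurable_const
  have hwF := R.wF_mem_region hD₀ t ω
  have key := R.pow_le_uniformLaw_region hD₀ hone hwF (r := 1 - r) (by linarith) (by linarith)
    (B := (⋃ v ∈ I, {w : Vec n | util w v ≤ r * η / 3})ᶜ) (fun w hw => by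
      simp only [Set.mem_compl_iff, Set.mem_iUnion, Set.mem_ofPred_eq, not_exists, not_le]
      intro v hv
      obtain ⟨s, hs, hclose⟩ := hI v hv
      have hrej := R.not_accepts_of_mem_closeRejection hη hclose
      have h0 := R.util_slack_nonneg_of_rejected hs hrej hw
      have h1 := hclose.1
      set a := G.slack (R.offer s ω)
      have h2 : util ((1 - (1 - r)) • G.wF + (1 - r) • w) a ≥ r * η := by
        rw [util_combo]
        have := mul_le_mul_of_nonneg_left h1 hr.le
        have := mul_nonneg (sub_nonneg.2 hr1.le) h0
        linarith
      have hmem : (1 - (1 - r)) • G.wF + (1 - r) • w ∈ stdSimplex ℝ (Fin (n + 1)) :=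
        convex_stdSimplex ℝ _ G.wF_mem (mem_stdSimplex_of_mem_region R hw) (by linarith)
          (by linarith) (by ring)
      have h3 := (abs_le.1 (abs_util_le hmem (a - v))).2
      rw [util_sub] at h3
      have : 0 < r * η := mul_pos hr hη
      linarith [hclose.2])
  rw [probReal_compl_eq_one_sub hmeas] at key
  linarith

lemma measurableSet_closeRejection [Fintype L] [Fintype F] (η r : ℝ) (v : Vec n) (t : ℕ) :
    MeasurableSet[R.ℱ (t + 1)] (R.closeRejection η r v t) := by
  have h : MeasurableSet {a : Vec n | η ≤ util G.wF a ∧ ‖a - v‖ < r} :=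
    (measurableSet_le measurable_const (continuous_util_right _).measurable).inter
      (measurableSet_lt (measurable_id.sub_const v).norm measurable_const)
  exact R.measurable_slack_offer t h

variable [IsProbabilityMeasure P]

lemma measure_inter_weight_le {t : ℕ} {A : Set Ω} (hA : MeasurableSet[R.ℱ t] A)
    {B : Set (Vec n)} (hB : MeasurableSet B) {q : ℝ} (hq : 0 ≤ q)
    (h : ∀ᵐ ω ∂P, ω ∈ A → (uniformLaw (R.region t ω)).real B ≤ q) :
    P (A ∩ R.weight t ⁻¹' B) ≤ ENNReal.ofReal q * P A := by
  have hA' := R.ℱ.le t A hA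
  have hWB : MeasurableSet (R.weight t ⁻¹' B) := R.ℱ.le (t + 1) _ (R.measurable_weight t hB)
  have hint : Integrable ((R.weight t ⁻¹' B).indicator fun _ => (1 : ℝ)) P :=
    (integrable_const 1).indicator hWB
  have h1 : P.real (A ∩ R.weight t ⁻¹' B) ≤ q * P.real A := by
    calc P.real (A ∩ R.weight t ⁻¹' B)
        = ∫ ω in A, (R.weight t ⁻¹' B).indicator (fun _ => (1 : ℝ)) ω ∂P := by
          rw [setIntegral_indicator hWB]; simp
      _ = ∫ ω in A, (P[(R.weight t ⁻¹' B).indicator (fun _ => (1 : ℝ)) | R.ℱ t]) ω ∂P :=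
          (setIntegral_condExp (R.ℱ.le t) hint hA).symm
      _ ≤ ∫ _ω in A, q ∂P := by
          refine integral_mono_ae integrable_condExp.integrableOn (integrable_const q) ?_
          rw [EventuallyLE, ae_restrict_iff' hA']
          filter_upwards [h, R.weight_law t B hB] with ω h1 h2 hω
          rw [h2]; exact h1 hω
      _ = q * P.real A := by simp [mul_comm]
  calc P (A ∩ R.weight t ⁻¹' B) = ENNReal.ofReal (P.real (A ∩ R.weight t ⁻¹' B)) := by simp
    _ ≤ ENNReal.ofReal (q * P.real A) := ENNReal.ofReal_le_ofReal h1
    _ = ENNReal.ofReal q * P A := by rw [ENNReal.ofReal_mul hq]; simp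

variable [Fintype L] [Fintype F]

/-- A rejection by margin `η` lies near a net point. Either that point is hit for the first time, or
it was hit before, and then the drawn weight falls into a thin part of the region. -/
lemma measure_rejected_le (hD₀ : D₀ ⊆ G.bestResponseData) {η r : ℝ} (hη : 0 < η) (hr : 0 < r)
    (hr1 : r < 1) {N : Finset (Vec n)}
    (hN : ∀ t ω, ∃ v ∈ N, ‖G.slack (R.offer t ω) - v‖ < r * η / 3) (t : ℕ) :
    P {ω | η ≤ util G.wF (G.slack (R.offer t ω))} ≤
      ENNReal.ofReal (1 - (1 - r) ^ n) +
        ∑ v ∈ N, P (disjointed (R.closeRejection η (r * η / 3) v) t) := by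
  classical
  set E := R.closeRejection η (r * η / 3) with hE
  -- This finite-valued variable is known before draw `t`; on each of its level sets, the set that
  -- the weight must enter is deterministic.
  set hits : Ω → Finset (Vec n) := fun ω => N.filter fun v => ∃ s < t, ω ∈ E v s with hhits
  have hmeas : ∀ I, MeasurableSet[R.ℱ t] (hits ⁻¹' {I}) := by
    intro I
    have hv : ∀ v, MeasurableSet[R.ℱ t] {ω | ∃ s < t, ω ∈ E v s} := by
      intro v
      have : {ω | ∃ s < t, ω ∈ E v s} = ⋃ s ∈ Set.Iio t, E v s := by ext; simp
      rw [this]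
      exact MeasurableSet.biUnion (Set.to_countable _) fun s hs =>
        R.ℱ.mono (Nat.succ_le_of_lt hs) _ (R.measurableSet_closeRejection _ _ v s)
    have : hits ⁻¹' {I} = {_ω | I ⊆ N} ∩
        ⋂ v ∈ (N : Set (Vec n)), {ω | (∃ s < t, ω ∈ E v s) ↔ v ∈ I} := by
      ext ω
      simp only [hhits, Set.mem_preimage, Set.mem_singleton_iff, Set.mem_inter_iff,
        Set.mem_ofPred_eq, Set.mem_iInter, Finset.mem_coe]
      constructor
      · rintro rfl
        exact ⟨Finset.filter_subset _ _, fun v hv => by simp [hv]⟩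
      · rintro ⟨h1, h2⟩
        ext v
        rw [Finset.mem_filter]
        exact ⟨fun h => (h2 v h.1).1 h.2, fun h => ⟨h1 h, (h2 v (h1 h)).2 h⟩⟩
    rw [this]
    refine (MeasurableSet.const _).inter
      (MeasurableSet.biInter N.countable_toSet fun v _ => ?_)
    by_cases hvI : v ∈ I
    · simpa [hvI] using hv v
    · simp only [hvI, iff_false]
      exact (hv v).compl
  have hcover : {ω | η ≤ util G.wF (G.slack (R.offer t ω))} ⊆
      (⋃ I ∈ N.powerset, hits ⁻¹' {I} ∩
        R.weight t ⁻¹' (⋃ v ∈ I, {w | util w v ≤ r * η / 3})) ∪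
      ⋃ v ∈ N, disjointed (E v) t := by
    intro ω hω
    obtain ⟨v, hvN, hv⟩ := hN t ω
    have hvE : ω ∈ E v t := ⟨hω, hv⟩
    by_cases h : ∃ s < t, ω ∈ E v s
    · left
      refine Set.mem_biUnion (Finset.mem_powerset.2 (Finset.filter_subset _ N))
        ⟨rfl, Set.mem_biUnion (Finset.mem_filter.2 ⟨hvN, h⟩) ?_⟩
      have h1 := R.util_slack_nonpos_of_rejected (R.not_accepts_of_mem_closeRejection hη hvE)
      have h2 := (abs_le.1 (abs_util_le
        (mem_stdSimplex_of_mem_region R (R.weight_mem_region t ω))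
        (G.slack (R.offer t ω) - v))).1
      rw [util_sub] at h2
      change util (R.weight t ω) v ≤ _
      linarith
    · right
      refine Set.mem_biUnion hvN ?_
      rw [disjointed_apply]
      refine ⟨hvE, fun hmem => h ?_⟩
      simpa using hmem
  refine (measure_mono hcover).trans ((measure_union_le _ _).trans
    (add_le_add ?_ (measure_biUnion_finset_le _ _)))
  have hq : 0 ≤ 1 - (1 - r) ^ n := by
    linarith [pow_le_one₀ (n := n) (sub_nonneg.2 hr1.le) (by linarith : 1 - r ≤ 1)]
  calc P (⋃ I ∈ N.powerset, hits ⁻¹' {I} ∩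
        R.weight t ⁻¹' (⋃ v ∈ I, {w | util w v ≤ r * η / 3}))
      ≤ ∑ I ∈ N.powerset, P (hits ⁻¹' {I} ∩
        R.weight t ⁻¹' (⋃ v ∈ I, {w | util w v ≤ r * η / 3})) := measure_biUnion_finset_le _ _
    _ ≤ ∑ I ∈ N.powerset, ENNReal.ofReal (1 - (1 - r) ^ n) * P (hits ⁻¹' {I}) := by
        refine Finset.sum_le_sum fun I _ => R.measure_inter_weight_le (hmeas I)
          (Finset.measurableSet_biUnion I fun v _ =>
            measurableSet_le (continuous_util_left v).measurable measurable_const) hq ?_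
        filter_upwards [R.ae_uniformLaw_univ] with ω hone hω
        refine R.uniformLaw_le_of_closeRejection hD₀ (hone t) hη hr hr1 fun v hv => ?_
        rw [← show hits ω = I from hω] at hv
        exact (Finset.mem_filter.1 hv).2
    _ = ENNReal.ofReal (1 - (1 - r) ^ n) * P (⋃ I ∈ N.powerset, hits ⁻¹' {I}) := by
        rw [← Finset.mul_sum, measure_biUnion_finset _ fun I _ => R.ℱ.le t _ (hmeas I)]
        intro I _ J _ hIJ
        exact Disjoint.preimage hits (Set.disjoint_singleton.2 hIJ)
    _ ≤ ENNReal.ofReal (1 - (1 - r) ^ n) * 1 := by gcongr; exact prob_le_one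
    _ = _ := mul_one _

theorem tendsto_measure_rejected (hwL : ∀ d, 0 < G.wL d) (hD₀ : D₀ ⊆ G.bestResponseData) {η : ℝ}
    (hη : 0 < η) :
    Tendsto (fun t => P {ω | η ≤ util G.wF (G.slack (R.offer t ω))}) atTop (𝓝 0) := by
  obtain ⟨C, -, hC⟩ := R.exists_slack_bound hwL
  rw [ENNReal.tendsto_nhds_zero]
  intro ε hε
  have hε2 : 0 < ε / 2 := ENNReal.half_pos hε.ne'
  have hlim : Tendsto (fun r : ℝ => ENNReal.ofReal (1 - (1 - r) ^ n)) (𝓝[>] 0) (𝓝 0) := by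
    have hc : Continuous fun r : ℝ => ENNReal.ofReal (1 - (1 - r) ^ n) :=
      ENNReal.continuous_ofReal.comp (by fun_prop)
    simpa using (hc.tendsto 0).mono_left nhdsWithin_le_nhds
  -- The order matters: `r` is fixed first, then the net, and only then does `t` tend to infinity,
  -- since the net depends on `r`.
  obtain ⟨r, hrε, hr, hr1⟩ := (((ENNReal.tendsto_nhds_zero.1 hlim) _ hε2).and
    (Ioo_mem_nhdsGT one_pos : Set.Ioo (0 : ℝ) 1 ∈ 𝓝[>] 0)).exists
  obtain ⟨N, -, hNfin, hN⟩ := finite_cover_balls_of_compact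
    (isCompact_closedBall (0 : Vec n) C) (show 0 < r * η / 3 by positivity)
  lift N to Finset (Vec n) using hNfin
  have hnet : ∀ t ω, ∃ v ∈ N, ‖G.slack (R.offer t ω) - v‖ < r * η / 3 := by
    intro t ω
    have h := hN (mem_closedBall_zero_iff.2 (hC t ω))
    simpa [dist_eq_norm] using h
  have hsum : Tendsto (fun t => ∑ v ∈ N, P (disjointed (R.closeRejection η (r * η / 3) v) t))
      atTop (𝓝 0) := by
    rw [← Finset.sum_const_zero (s := N)]
    exact tendsto_finsetSum _ fun v _ => tendsto_measure_first_hit P fun t =>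
      R.ℱ.le _ _ (R.measurableSet_closeRejection _ _ v t)
  filter_upwards [(ENNReal.tendsto_nhds_zero.1 hsum) _ hε2] with t ht
  calc P {ω | η ≤ util G.wF (G.slack (R.offer t ω))} ≤ _ :=
        R.measure_rejected_le hD₀ hη hr hr1 hnet t
    _ ≤ ε / 2 + ε / 2 := add_le_add hrε ht
    _ = ε := ENNReal.add_halves ε

theorem ae_tendsto_leaderUtil_offer (hwL : ∀ d, 0 < G.wL d) (hD₀ : D₀ ⊆ G.bestResponseData) :
    ∀ᵐ ω ∂P, Tendsto (fun t => G.leaderUtil (R.offer t ω)) atTop (𝓝 (G.optValue G.wF)) := by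
  filter_upwards [R.ae_visits hD₀] with ω hω
  exact R.tendsto_leaderUtil_offer hwL hD₀ hω

/-- An offer far from every optimal one either misses the optimal value by δ or is rejected by
margin δ; both events have vanishing probability. -/
theorem tendsto_measure_not_near_optimal (hwL : ∀ d, 0 < G.wL d)
    (hD₀ : D₀ ⊆ G.bestResponseData) {ε : ℝ} (hε : 0 < ε) :
    Tendsto (fun t => P {ω | ¬ ∃ m, G.IsOptimal m ∧ m.lead = (R.offer t ω).lead ∧
      m.foll = (R.offer t ω).foll ∧ ‖(R.offer t ω).cost - m.cost‖ < ε}) atTop (𝓝 0) := by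
  obtain ⟨δ, hδ, h⟩ := G.exists_near_optimal hwL hε
  have hval := tendstoInMeasure_iff_dist.1 (tendstoInMeasure_of_tendsto_ae
    (fun t => (R.measurable_leaderUtil_offer t).aestronglyMeasurable)
    (R.ae_tendsto_leaderUtil_offer hwL hD₀)) δ hδ
  have hrej := R.tendsto_measure_rejected hwL hD₀ hδ
  refine tendsto_of_tendsto_of_tendsto_of_le_of_le tendsto_const_nhds
    (by simpa using hval.add hrej) (fun _ => zero_le) fun t => ?_
  refine (measure_mono fun ω hω => ?_).trans (measure_union_le _ _)
  by_contra hcon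
  rw [Set.mem_union, not_or] at hcon
  have h1 : dist (G.leaderUtil (R.offer t ω)) (G.optValue G.wF) < δ := not_le.1 hcon.1
  rw [Real.dist_eq, abs_lt] at h1
  exact hω (h _ (R.offer_cost_nonneg t ω) (not_le.1 hcon.2) (by linarith [h1.1]))

end Run

end Stackelberg

theorem mainTheorem2 {n : ℕ} {L F : Type*} [Fintype L] [Fintype F]
    (G : Stackelberg.Game n L F)
    (hwL : ∀ d, 0 < G.wL d) (hwF : ∀ d, 0 < G.wF d) (hG : G.Beneficial)
    (crit : Stackelberg.Criterion)
    (D₀ : Set (Stackelberg.Comparison n)) (hD₀ : D₀ ⊆ G.bestResponseData)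
    {Ω : Type*} [MeasurableSpace Ω] (P : Measure Ω) [IsProbabilityMeasure P]
    (R : Stackelberg.Run G crit D₀ P) :
    (∀ ε : ℝ, 0 < ε →
      Tendsto (fun t => P {ω | ¬ ∃ m, G.IsOptimal m ∧
          m.lead = (R.offer t ω).lead ∧ m.foll = (R.offer t ω).foll ∧
          ‖(R.offer t ω).cost - m.cost‖ < ε}) atTop (𝓝 0)) ∧
    (∀ m, G.IsOptimal m → ∀ᵐ ω ∂P,
      Tendsto (fun t => G.leaderUtil (R.offer t ω)) atTop (𝓝 (G.leaderUtil m))) := by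
  refine ⟨fun ε hε => R.tendsto_measure_not_near_optimal hwL hD₀ hε, fun m hm => ?_⟩
  rw [hm.leaderUtil_eq_optValue]
  exact R.ae_tendsto_leaderUtil_offer hwL hD₀
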